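/- Let $k$ be a commutative artinian ring, $n\ge 1$, and let $(\mathcal C,\mathbb E,\mathfrak s)$ be a $k$-linear $n$-exangulated category (that is, $\mathcal C$ is a $k$-linear additive category, $\mathbb E\colon\mathcal C^{op}\times\mathcal C\to k\text{-Mod}$ is a $k$-bilinear functor, and $\mathfrak s$ is an exact realization of $\mathbb E$ satisfying the axioms (EA1), (EA2), (EA2$^{op}$) of Herschend–Liu–Nakaoka). Assume that $\mathcal C$ is Krull–Schmidt, that it is Ext-finite (every $\mathbb E(B,A)$ is a finitely generated $k$-module), and that for all composable $f,g$: if $g\circ f$ is a deflation then so is $g$, and if $g\circ f$ is an inflation then so is $f$. Let $D=\operatorname{Hom}_k(-,\check k)$, where $\check k$ is the minimal injective cogenerator of the category of finitely generated $k$-modules. A morphism $f\colon X\to Y$ is $n$-projectively trivial if $\mathbb E(f,Z)=0$ for all $Z$; the stable category $\underline{\mathcal C}$ is the quotient of $\mathcal C$ by these morphisms. Let $\mathcal C_l$ be the class of objects $X$ of $\mathcal C$ for which the functor $D\mathbb E(-,X)\colon\underline{\mathcal C}\to k\text{-mod}$ is representable, i.e. isomorphic to $\underline{\mathcal C}(W,-)$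 for some object $W$. A morphism $f\colon X\to Y$ is right $C$-determined if every $g\colon L\to Y$ such that $g\circ h$ factors through $f$ for each $h\colon C\to L$ factors itself through $f$. A right minimal version of $f\colon X\to Y$ is a morphism $f'\colon X'\to Y$ such that $f$ and $f'$ factor through each other and every $a\colon X'\to X'$ with $f'a=f'$ is an isomorphism. For a deflation $\alpha\colon X\to Y$, an intrinsic weak $n$-kernel of $\alpha$ is the first term $Z_0$ of a distinguished $n$-exangle $$Z_0\xrightarrow{d_0}Z_1\xrightarrow{d_1}\cdots\xrightarrow{d_{n-1}}Z_n\xrightarrow{\alpha'}Y\dashrightarrow$$ in which $\alpha'$ is a right minimal version of $\alpha$; it is called minimal if the $n$-exangle can be chosen with $d_0,\dots,d_{n-1}$ in the Jacobson radical of $\mathcal C$. Then every deflation $\alpha$ in $\mathcal C$ has a minimal intrinsic weak $n$-kernel, and for each minimal intrinsic weak $n$-kernel $Z_0$ of $\alpha$ the following statements are equivalent. 1. $\alpha$ is right $C$-determined for some object $C$ of $\mathcal C$. 2. $Z_0$ lies in $\mathcal C_l$. 3. Some intrinsic weak $n$-kernel of $\alpha$ lies in $\mathcal C_l$. -/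

import Mathlib

open CategoryTheory CategoryTheory.Limits Opposite

universe t w v u

noncomputable section

namespace NExang

attribute [local instance] hasBinaryBiproducts_of_finite_biproducts

/-! ### Morphisms in an additive category -/

section Morphisms

variable {C : Type u} [Category.{v} C]

/-- `f : X ⟶ Y` is right `W`-determined: a morphism `g : L ⟶ Y` factors through `f` as soon as
all composites `W ⟶ L ⟶ Y` with `g` do. -/
def RightDetermined {X Y : C} (f : X ⟶ Y) (W : C) : Prop :=
  ∀ (L : C) (g : L ⟶ Y), (∀ h : W ⟶ L, ∃ s : W ⟶ X, s ≫ f = h ≫ g) → ∃ s : L ⟶ X, s ≫ f = g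

/-- `f` and `f'` factor through each other. -/
def RightEquivalent {X X' Y : C} (f : X ⟶ Y) (f' : X' ⟶ Y) : Prop :=
  (∃ a : X ⟶ X', a ≫ f' = f) ∧ ∃ b : X' ⟶ X, b ≫ f = f'

/-- Every endomorphism `a` of the source with `f ∘ a = f` is an isomorphism. -/
def RightMinimal {X Y : C} (f : X ⟶ Y) : Prop :=
  ∀ a : X ⟶ X, a ≫ f = f → IsIso a

/-- `f` lies in the Jacobson radical of the category. -/
def InRad [Preadditive C] {X Y : C} (f : X ⟶ Y) : Prop :=
  ∀ g : Y ⟶ X, IsIso (𝟙 X - f ≫ g)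

variable (C) in
/-- Every object is a finite direct sum of objects with local endomorphism rings. -/
def KrullSchmidt [Preadditive C] [HasFiniteBiproducts C] : Prop :=
  ∀ X : C, ∃ (m : ℕ) (Z : Fin m → C),
    (∀ i, IsLocalRing (End (Z i))) ∧ Nonempty (X ≅ ⨁ Z)

end Morphisms

/-! ### Complexes with `n + 2` terms and prescribed ends -/

section Complexes

variable {C : Type u} [Category.{v} C] [Preadditive C]

/-- A complex `X₀ ⟶ X₁ ⟶ ⋯ ⟶ Xₙ ⟶ Xₙ₊₁`, zero in the other degrees, whose ends `X₀` and `Xₙ₊₁`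
are identified with the objects `A` and `B`. -/
structure EndedComplex (n : ℕ) (A B : C) where
  cpx : CochainComplex C ℕ
  isZero : ∀ i, n + 1 < i → IsZero (cpx.X i)
  left : cpx.X 0 ≅ A
  right : cpx.X (n + 1) ≅ B

namespace EndedComplex

variable {n : ℕ} {A B A' B' : C}

/-- The first differential `A ⟶ X₁`. -/
def first (X : EndedComplex n A B) : A ⟶ X.cpx.X 1 := X.left.inv ≫ X.cpx.d 0 1

/-- The last differential `Xₙ ⟶ B`. -/
def last (X : EndedComplex n A B) : X.cpx.X n ⟶ B := X.cpx.d n (n + 1) ≫ X.right.hom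

/-- `f` is a morphism of complexes of the form `(a, f₁, …, fₙ, c)`. -/
def IsLift (X : EndedComplex n A B) (Y : EndedComplex n A' B') (a : A ⟶ A') (c : B ⟶ B')
    (f : X.cpx ⟶ Y.cpx) : Prop :=
  f.f 0 ≫ Y.left.hom = X.left.hom ≫ a ∧ f.f (n + 1) ≫ Y.right.hom = X.right.hom ≫ c

/-- Homotopy equivalence through morphisms that are the identity at both ends. -/
def HtpyEquiv (X Y : EndedComplex n A B) : Prop :=
  ∃ (f : X.cpx ⟶ Y.cpx) (g : Y.cpx ⟶ X.cpx),
    X.IsLift Y (𝟙 A) (𝟙 B) f ∧ Y.IsLift X (𝟙 A) (𝟙 B) g ∧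
      Nonempty (Homotopy (f ≫ g) (𝟙 X.cpx)) ∧ Nonempty (Homotopy (g ≫ f) (𝟙 Y.cpx))

variable [HasFiniteBiproducts C]

/-- `M` is (isomorphic, with the same ends, to) the mapping cone
`X₁ ⟶ X₂ ⊞ Y₁ ⟶ ⋯ ⟶ Xₙ₊₁ ⊞ Yₙ ⟶ Yₙ₊₁` of a morphism `f : X ⟶ Y` whose component in degree `0` is
an identity. The matrices of the differentials are `[-d; f]`, then `[-d, 0; f, d]`, and finally
`[f, d]`. Since `Xₙ₊₂ = 0`, the term in degree `n + 1` is written as `Xₙ₊₂ ⊞ Yₙ₊₁`. -/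
def IsCone (X : EndedComplex n A B) (Y : EndedComplex n A B') (f : X.cpx ⟶ Y.cpx)
    (M : EndedComplex n (X.cpx.X 1) B') : Prop :=
  ∃ φ : ∀ j : ℕ, M.cpx.X (j + 1) ≅ X.cpx.X (j + 2) ⊞ Y.cpx.X (j + 1),
    M.first ≫ (φ 0).hom = biprod.lift (-X.cpx.d 1 2) (f.f 1) ∧
    (∀ j : ℕ, M.cpx.d (j + 1) (j + 2) ≫ (φ (j + 1)).hom =
      (φ j).hom ≫ Biprod.ofComponents (-X.cpx.d (j + 2) (j + 3)) (f.f (j + 2))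
        0 (Y.cpx.d (j + 1) (j + 2))) ∧
    M.right.hom = (φ n).hom ≫ biprod.snd ≫ Y.right.hom

/-- `N` is (isomorphic, with the same ends, to) the mapping cocone
`X₀ ⟶ X₁ ⊞ Y₀ ⟶ ⋯ ⟶ Xₙ ⊞ Yₙ₋₁ ⟶ Yₙ` of a morphism `h : X ⟶ Y` whose component in degree `n + 1`
is an identity. It is the mapping cone formed in the opposite category, hence the matrices of the
differentials are `[d; h]`, then `[d, 0; h, -d]`, and finally `[h, -d]`. -/
def IsCocone (X : EndedComplex n A B) (Y : EndedComplex n A' B) (h : X.cpx ⟶ Y.cpx)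
    (N : EndedComplex n A (Y.cpx.X n)) : Prop :=
  ∃ φ : ∀ i j : ℕ, j + 1 = i → i ≤ n → (N.cpx.X i ≅ X.cpx.X i ⊞ Y.cpx.X j),
    (∀ hn : 1 ≤ n, N.first ≫ (φ 1 0 rfl hn).hom =
      X.left.inv ≫ biprod.lift (X.cpx.d 0 1) (h.f 0)) ∧
    (∀ (j : ℕ) (hj : j + 2 ≤ n), N.cpx.d (j + 1) (j + 2) ≫ (φ (j + 2) (j + 1) rfl hj).hom =
      (φ (j + 1) j rfl (by omega)).hom ≫ Biprod.ofComponents (X.cpx.d (j + 1) (j + 2))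
        (h.f (j + 1)) 0 (-Y.cpx.d j (j + 1))) ∧
    (∀ (j : ℕ) (hj : j + 1 = n), N.last =
      (φ n j hj le_rfl).hom ≫ biprod.desc (h.f n) (-Y.cpx.d j n))

end EndedComplex

end Complexes

/-! ### Extensions -/

section Extensions

variable {k : Type t} [CommRing k] {C : Type u} [Category.{v} C]

/-- The module `𝔼(B, A)` of extensions. -/
abbrev Extn (E : Cᵒᵖ ⥤ C ⥤ ModuleCat.{w} k) (B A : C) : Type w := (E.obj (op B)).obj A

/-- `a_* : 𝔼(B, A) → 𝔼(B, A')`. -/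
def push (E : Cᵒᵖ ⥤ C ⥤ ModuleCat.{w} k) {A A' : C} (a : A ⟶ A') (B : C) :
    Extn E B A →ₗ[k] Extn E B A' :=
  ((E.obj (op B)).map a).hom

/-- `c^* : 𝔼(B, A) → 𝔼(B', A)`. -/
def pull (E : Cᵒᵖ ⥤ C ⥤ ModuleCat.{w} k) {B B' : C} (c : B' ⟶ B) (A : C) :
    Extn E B A →ₗ[k] Extn E B' A :=
  ((E.map c.op).app A).hom

lemma pull_id (E : Cᵒᵖ ⥤ C ⥤ ModuleCat.{w} k) (B A : C) : pull E (𝟙 B) A = LinearMap.id := by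
  simp [pull]

lemma pull_comp (E : Cᵒᵖ ⥤ C ⥤ ModuleCat.{w} k) {B B' B'' : C} (c : B' ⟶ B) (c' : B'' ⟶ B')
    (A : C) : pull E (c' ≫ c) A = (pull E c' A).comp (pull E c A) := by
  simp [pull]

/-- `𝔼` is `k`-bilinear. -/
structure IsBilinear [Preadditive C] [Linear k C] (E : Cᵒᵖ ⥤ C ⥤ ModuleCat.{w} k) : Prop where
  push_add : ∀ {A A' : C} (a a' : A ⟶ A') (B : C), push E (a + a') B = push E a B + push E a' B
  push_smul : ∀ {A A' : C} (r : k) (a : A ⟶ A') (B : C), push E (r • a) B = r • push E a B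
  pull_add : ∀ {B B' : C} (c c' : B' ⟶ B) (A : C), pull E (c + c') A = pull E c A + pull E c' A
  pull_smul : ∀ {B B' : C} (r : k) (c : B' ⟶ B) (A : C), pull E (r • c) A = r • pull E c A

/-- The pair `⟨X, δ⟩` is an `n`-exangle: it is an attached complex (`first_push`, `last_pull`) and
the two associated sequences of functors
`C(-, X₀) ⟶ ⋯ ⟶ C(-, Xₙ₊₁) ⟶ 𝔼(-, X₀)` and `C(Xₙ₊₁, -) ⟶ ⋯ ⟶ C(X₀, -) ⟶ 𝔼(Xₙ₊₁, -)` are exact. -/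
structure IsExangle [Preadditive C] (E : Cᵒᵖ ⥤ C ⥤ ModuleCat.{w} k) {n : ℕ} {A B : C}
    (X : EndedComplex n A B) (δ : Extn E B A) : Prop where
  first_push : push E X.first B δ = 0
  last_pull : pull E X.last A δ = 0
  covariant : ∀ (T : C) (i : ℕ), i < n → ∀ g : T ⟶ X.cpx.X (i + 1),
    g ≫ X.cpx.d (i + 1) (i + 2) = 0 → ∃ h : T ⟶ X.cpx.X i, h ≫ X.cpx.d i (i + 1) = g
  covariant_end : ∀ (T : C) (g : T ⟶ B), pull E g A δ = 0 → ∃ h : T ⟶ X.cpx.X n, h ≫ X.last = g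
  contravariant : ∀ (T : C) (i : ℕ), i < n → ∀ g : X.cpx.X (i + 1) ⟶ T,
    X.cpx.d i (i + 1) ≫ g = 0 → ∃ h : X.cpx.X (i + 2) ⟶ T, X.cpx.d (i + 1) (i + 2) ≫ h = g
  contravariant_end : ∀ (T : C) (g : A ⟶ T), push E g B δ = 0 →
    ∃ h : X.cpx.X 1 ⟶ T, X.first ≫ h = g

end Extensions

/-! ### `n`-exangulated categories -/

/-- A bifunctor `𝔼` together with an exact realization `𝔰` of it. `Real δ X` means `𝔰(δ) = [X]`. -/
structure ExactRealization (k : Type t) [CommRing k] (C : Type u) [Category.{v} C] [Preadditive C]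
    [Linear k C] (n : ℕ) where
  E : Cᵒᵖ ⥤ C ⥤ ModuleCat.{w} k
  bilinear : IsBilinear E
  Real : ∀ {A B : C}, Extn E B A → EndedComplex n A B → Prop
  /-- `𝔰` attaches to each extension exactly one homotopy equivalence class. -/
  exists_real : ∀ {A B : C} (δ : Extn E B A), ∃ X : EndedComplex n A B, Real δ X
  real_iff : ∀ {A B : C} (δ : Extn E B A) (X Y : EndedComplex n A B), Real δ X →
    (Real δ Y ↔ X.HtpyEquiv Y)
  /-- (R0) -/
  exists_lift : ∀ {A B A' B' : C} (δ : Extn E B A) (ρ : Extn E B' A') (X : EndedComplex n A B)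
    (Y : EndedComplex n A' B'), Real δ X → Real ρ Y → ∀ (a : A ⟶ A') (c : B ⟶ B'),
    push E a B δ = pull E c A' ρ → ∃ f : X.cpx ⟶ Y.cpx, X.IsLift Y a c f
  /-- (R1) -/
  isExangle : ∀ {A B : C} (δ : Extn E B A) (X : EndedComplex n A B), Real δ X → IsExangle E X δ
  /-- (R2): the zero element of `𝔼(0, A)` is realized by `A = A ⟶ 0 ⟶ ⋯ ⟶ 0`. -/
  real_zero_right : ∀ A Z : C, IsZero Z → ∃ X : EndedComplex n A Z, Real (0 : Extn E Z A) X ∧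
    IsIso (X.cpx.d 0 1) ∧ ∀ i, 2 ≤ i → IsZero (X.cpx.X i)
  /-- (R2), dual part: the zero element of `𝔼(B, 0)` is realized by `0 ⟶ ⋯ ⟶ 0 ⟶ B = B`. -/
  real_zero_left : ∀ B Z : C, IsZero Z → ∃ X : EndedComplex n Z B, Real (0 : Extn E B Z) X ∧
    IsIso (X.cpx.d n (n + 1)) ∧ ∀ i, i < n → IsZero (X.cpx.X i)

namespace ExactRealization

variable {k : Type t} [CommRing k] {C : Type u} [Category.{v} C] [Preadditive C] [Linear k C]
  {n : ℕ} (S : ExactRealization.{t, w} k C n)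

/-- `f` is, up to an isomorphism of its target, the first morphism of a conflation. -/
def IsInflation {A Z : C} (f : A ⟶ Z) : Prop :=
  ∃ (B : C) (δ : Extn S.E B A) (X : EndedComplex n A B), S.Real δ X ∧
    ∃ e : X.cpx.X 1 ≅ Z, X.first ≫ e.hom = f

/-- `g` is, up to an isomorphism of its source, the last morphism of a conflation. -/
def IsDeflation {Z B : C} (g : Z ⟶ B) : Prop :=
  ∃ (A : C) (δ : Extn S.E B A) (X : EndedComplex n A B), S.Real δ X ∧
    ∃ e : X.cpx.X n ≅ Z, e.hom ≫ g = X.last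

end ExactRealization

/-- A `k`-linear `n`-exangulated structure `(C, 𝔼, 𝔰)` on the `k`-linear additive category `C`. -/
structure NExangulated (k : Type t) [CommRing k] (C : Type u) [Category.{v} C] [Preadditive C]
    [Linear k C] [HasFiniteBiproducts C] (n : ℕ) extends ExactRealization.{t, w} k C n where
  /-- (EA1) -/
  inflation_comp : ∀ {A B D : C} (f : A ⟶ B) (g : B ⟶ D),
    toExactRealization.IsInflation f → toExactRealization.IsInflation g →
      toExactRealization.IsInflation (f ≫ g)
  deflation_comp : ∀ {A B D : C} (f : A ⟶ B) (g : B ⟶ D),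
    toExactRealization.IsDeflation f → toExactRealization.IsDeflation g →
      toExactRealization.IsDeflation (f ≫ g)
  /-- (EA2): `(id, c)` has a good lift. -/
  good_lift : ∀ {A B D : C} (ρ : Extn E D A) (c : B ⟶ D) (X : EndedComplex n A B)
    (Y : EndedComplex n A D), Real (pull E c A ρ) X → Real ρ Y →
    ∃ f : X.cpx ⟶ Y.cpx, X.IsLift Y (𝟙 A) c f ∧
      ∃ M : EndedComplex n (X.cpx.X 1) D, X.IsCone Y f M ∧ Real (push E X.first D ρ) M
  /-- (EA2ᵒᵖ): `(a, id)` has a good lift. -/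
  good_lift_op : ∀ {A A' B : C} (ρ : Extn E B A) (a : A ⟶ A') (X : EndedComplex n A B)
    (Y : EndedComplex n A' B), Real ρ X → Real (push E a B ρ) Y →
    ∃ h : X.cpx ⟶ Y.cpx, X.IsLift Y a (𝟙 B) h ∧
      ∃ N : EndedComplex n A (Y.cpx.X n), X.IsCocone Y h N ∧ Real (pull E Y.last A ρ) N

/-! ### The stable category and the functors `D𝔼(-, X)` -/

section Stable

variable {k : Type t} [CommRing k] {C : Type u} [Category.{v} C] [Preadditive C]

/-- `f : X ⟶ Y` is `n`-projectively trivial: `𝔼(f, Z) = 0` for all `Z`. -/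
def ProjTrivial (E : Cᵒᵖ ⥤ C ⥤ ModuleCat.{w} k) {X Y : C} (f : X ⟶ Y) : Prop :=
  ∀ Z : C, pull E f Z = 0

/-- Two morphisms agree in the stable category. -/
def stableRel (E : Cᵒᵖ ⥤ C ⥤ ModuleCat.{w} k) : HomRel C :=
  fun _ _ f g => ProjTrivial E (f - g)

/-- The stable category: same objects, morphisms modulo the `n`-projectively trivial ones. -/
abbrev StableCategory (E : Cᵒᵖ ⥤ C ⥤ ModuleCat.{w} k) : Type u :=
  CategoryTheory.Quotient (stableRel E)

variable (K : Type t) [AddCommGroup K] [Module k K]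

/-- The functor `Hom_k(𝔼(-, X), K)` on `C`. -/
def dualExt (E : Cᵒᵖ ⥤ C ⥤ ModuleCat.{w} k) (X : C) : C ⥤ ModuleCat.{max w t} k where
  obj Y := ModuleCat.of k (Extn E Y X →ₗ[k] K)
  map f := ModuleCat.ofHom (LinearMap.lcomp k K (pull E f X))
  map_id Y := by
    ext φ
    simp [pull_id]
  map_comp f g := by
    ext φ
    simp [pull_comp]

/-- The functor `Hom_k(𝔼(-, X), K)` on the stable category. -/
def stableDualExt [Linear k C] {E : Cᵒᵖ ⥤ C ⥤ ModuleCat.{w} k} (hE : IsBilinear E) (X : C) :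
    StableCategory E ⥤ ModuleCat.{max w t} k :=
  CategoryTheory.Quotient.lift (stableRel E) (dualExt K E X) (by
    intro Y Y' f g h
    have hfg : pull E f X = pull E g X := by
      have h1 := hE.pull_add (f - g) g X
      rw [sub_add_cancel, h X, zero_add] at h1
      exact h1
    simp only [dualExt, hfg])

end Stable

/-- `K` is an injective cogenerator for the category of finitely generated `k`-modules: it is a
finitely generated injective module, and every nonzero element of a finitely generated module is
detected by a homomorphism to `K`. -/
structure IsInjCogenerator (k : Type t) [CommRing k] (K : Type t) [AddCommGroup K] [Module k K] :
    Prop where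
  finite : Module.Finite k K
  injective : Module.Injective k K
  cogenerator : ∀ (M : Type t) [AddCommGroup M] [Module k M] [Module.Finite k M] (m : M),
    m ≠ 0 → ∃ φ : M →ₗ[k] K, φ m ≠ 0

/-- `K` is the minimal injective cogenerator for the category of finitely generated `k`-modules (the
injective envelope of `k / rad k` when `k` is artinian; unique up to isomorphism): an injective
cogenerator no proper submodule of which is an injective cogenerator. -/
structure IsMinInjCogenerator (k : Type t) [CommRing k] (K : Type t) [AddCommGroup K]
    [Module k K] : Prop extends IsInjCogenerator k K where
  minimal : ∀ N : Submodule k K, IsInjCogenerator k N → N = ⊤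

namespace NExangulated

variable {k : Type t} [CommRing k] {C : Type u} [Category.{v} C] [Preadditive C] [Linear k C]
  [HasFiniteBiproducts C] {n : ℕ} (S : NExangulated.{t, w} k C n)

/-- All extension modules are finitely generated. -/
def ExtFinite : Prop := ∀ A B : C, Module.Finite k (Extn S.E B A)

/-- The standing condition on composites: if `g ∘ f` is a deflation, then so is `g`; if `g ∘ f` is
an inflation, then so is `f`. -/
structure WIC : Prop where
  deflation : ∀ {A B D : C} (f : A ⟶ B) (g : B ⟶ D), S.IsDeflation (f ≫ g) → S.IsDeflation g
  inflation : ∀ {A B D : C} (f : A ⟶ B) (g : B ⟶ D), S.IsInflation (f ≫ g) → S.IsInflation f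

/-- `X` lies in `C_l`: the functor `D𝔼(-, X)` on the stable category is representable, where
`D = Hom_k(-, K)`. -/
def InCl (K : Type t) [AddCommGroup K] [Module k K] (X : C) : Prop :=
  ∃ W : StableCategory S.E,
    Nonempty ((stableDualExt K S.bilinear X ⋙ forget (ModuleCat k)).CorepresentableBy W)

/-- `Z` is an intrinsic weak `n`-kernel of `α : X ⟶ Y`: it is the first term of a distinguished
`n`-exangle whose last morphism is a right minimal version of `α`. -/
def IsIntrinsicWeakKernel {X Y : C} (α : X ⟶ Y) (Z : C) : Prop :=
  ∃ (δ : Extn S.E Y Z) (U : EndedComplex n Z Y), S.Real δ U ∧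
    RightMinimal U.last ∧ RightEquivalent U.last α

/-- `Z` is a minimal intrinsic weak `n`-kernel of `α`: the distinguished `n`-exangle can be chosen
such that moreover all its morphisms except the last one are in the radical. -/
def IsMinimalIntrinsicWeakKernel {X Y : C} (α : X ⟶ Y) (Z : C) : Prop :=
  ∃ (δ : Extn S.E Y Z) (U : EndedComplex n Z Y), S.Real δ U ∧
    RightMinimal U.last ∧ RightEquivalent U.last α ∧
    ∀ i, i < n → InRad (U.cpx.d i (i + 1))

end NExangulated

end NExang

end

noncomputable section

namespace NExang

attribute [local instance] hasBinaryBiproducts_of_finite_biproducts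

/-! ### Matlis duality over an artinian ring -/

section Matlis

variable {k : Type t} [CommRing k] {K : Type t} [AddCommGroup K] [Module k K]

/-! Let `δ` in `𝔼(Y, Z)` be realized by an exangle whose last morphism is right equivalent to `α`. A
morphism `g` factors through `α` exactly when `g^*δ = 0`, so determinedness of `α` becomes a
question about the functor `𝔼(-, Z)`.

Existence of a minimal kernel rests on counting indecomposable summands. For `n = 1`, a right
minimal version of `α` is a deflation, and right minimality puts its kernel map in the radical. For
`n ≥ 2`, choose `δ` with the fewest summands in `Z`, then a realization with the fewest summands in
the inner terms: a differential outside the radical would let a summand be removed.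

If `D𝔼(-, Z)` is representable, every form on `𝔼(L, Z)` is `η ∘ h^*` for one fixed form `η` on some
`𝔼(W, Z)`. When `g^*δ ≠ 0`, a form detects it, hence `(g ∘ h)^*δ ≠ 0` for some `h : W ⟶ L`; so `α`
is right `W`-determined.

Conversely, let `α` be right `W`-determined and `Z` minimal. Every `φ` from `Z` that is not a split
monomorphism kills a nonzero element of `𝔼(W, Z)` (`NExangulated.exists_push_eq_zero`). This passes
to each indecomposable summand of `Z`, and since `𝔼(W, -)` takes artinian values, a minimal kernel
yields an almost split extension `ε` starting there (`NExangulated.exists_isAlmostSplit`). Any form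
nonzero on `ε` is universal (`IsAlmostSplit.exists_isUniversalForm`), which is Auslander–Reiten
duality; it needs Matlis duality in the form `IsMinInjCogenerator.eq_top`. Universal forms on the
summands add up to one for `Z`. -/

lemma IsInjCogenerator.exists_ne_zero (hK : IsInjCogenerator k K) {M : Type w} [AddCommGroup M]
    [Module k M] [Module.Finite k M] {m : M} (hm : m ≠ 0) : ∃ φ : M →ₗ[k] K, φ m ≠ 0 := by
  obtain ⟨r, f, hf⟩ := Module.Finite.exists_fin' k M
  -- `M` may live in another universe than `k`; its model as a quotient of a finite free module does
  -- not.
  let e := f.quotKerEquivOfSurjective hf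
  obtain ⟨φ, hφ⟩ := hK.cogenerator _ (e.symm m) (by simpa using hm)
  exact ⟨φ ∘ₗ e.symm.toLinearMap, hφ⟩

/-- An injective module in which every `k / 𝔪` embeds detects the nonzero elements of all modules. -/
lemma exists_ne_zero_of_injective {R : Type t} [AddCommGroup R] [Module k R]
    (hR : Module.Injective k R)
    (h : ∀ I : Ideal k, I.IsMaximal → ∃ r : R, r ≠ 0 ∧ ∀ a ∈ I, a • r = 0)
    {M : Type t} [AddCommGroup M] [Module k M] {m : M} (hm : m ≠ 0) :
    ∃ φ : M →ₗ[k] R, φ m ≠ 0 := by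
  have hne : Ideal.torsionOf k M m ≠ ⊤ := by
    rwa [Ne, Ideal.torsionOf_eq_top_iff]
  obtain ⟨I, hI, hle⟩ := Ideal.exists_le_maximal _ hne
  obtain ⟨r, hr, hIr⟩ := h I hI
  have hle' : Ideal.torsionOf k M m ≤ LinearMap.ker (LinearMap.toSpanSingleton k R r) :=
    fun a ha => by simpa using hIr a (hle ha)
  let ψ : (k ⧸ Ideal.torsionOf k M m) →ₗ[k] R := Submodule.liftQ _ _ hle'
  let ι : (k ⧸ Ideal.torsionOf k M m) →ₗ[k] M :=
    Submodule.liftQ (Ideal.torsionOf k M m) (LinearMap.toSpanSingleton k M m) le_rfl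
  have hι : Function.Injective ι := by
    rw [← LinearMap.ker_eq_bot]
    exact Submodule.ker_liftQ_eq_bot' _ _ rfl
  obtain ⟨φ, hφ⟩ := hR.out ι hι ψ
  refine ⟨φ, ?_⟩
  have h1 := hφ (Submodule.Quotient.mk 1)
  have h2 : ι (Submodule.Quotient.mk 1) = m := one_smul k m
  have h3 : ψ (Submodule.Quotient.mk 1) = r := one_smul k r
  rw [h2, h3] at h1
  rwa [h1]

lemma injective_of_isCompl {M : Type t} [AddCommGroup M] [Module k M] (hM : Module.Injective k M)
    {p q : Submodule k M} (hpq : IsCompl p q) : Module.Injective k p := by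
  refine ⟨fun X Y _ _ _ _ f hf g => ?_⟩
  obtain ⟨h, hh⟩ := hM.out f hf (p.subtype ∘ₗ g)
  refine ⟨p.projectionOnto q hpq ∘ₗ h, fun x => ?_⟩
  simp only [LinearMap.comp_apply, hh, Submodule.subtype_apply]
  exact Submodule.projectionOnto_apply_left hpq (g x)

/-- Two homomorphisms from a simple module to the minimal injective cogenerator are
proportional. -/
lemma IsMinInjCogenerator.exists_smul_eq [IsArtinianRing k] (hK : IsMinInjCogenerator k K)
    {S : Type w} [AddCommGroup S] [Module k S] [IsSimpleModule k S] (ψ φ : S →ₗ[k] K)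
    (hψ : ψ ≠ 0) : ∃ c : k, φ = c • ψ := by
  by_contra hφ
  have := hK.finite
  have hφ0 : φ ≠ 0 := fun h => hφ ⟨0, by simp [h]⟩
  have hψi : Function.Injective ψ := (LinearMap.injective_or_eq_zero ψ).resolve_right hψ
  have hφi : Function.Injective φ := (LinearMap.injective_or_eq_zero φ).resolve_right hφ0
  set soc : Submodule k K := sSup {m : Submodule k K | IsSimpleModule k m} with hsoc
  have hss : IsSemisimpleModule k soc := by
    rw [hsoc, sSup_eq_iSup]
    refine isSemisimpleModule_biSup_of_isSemisimpleModule_submodule fun m hm => ?_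
    have : IsSimpleModule k m := hm
    infer_instance
  have hmem : ∀ (I : Ideal k), I.IsMaximal → ∀ x : K, (∀ a ∈ I, a • x = 0) → x ∈ soc := by
    intro I hI x hx
    by_cases hx0 : x = 0
    · simp [hx0]
    have hle : I ≤ Ideal.torsionOf k K x := fun a ha => hx a ha
    have heq : I = Ideal.torsionOf k K x :=
      hI.eq_of_le (by rwa [Ne, Ideal.torsionOf_eq_top_iff]) hle
    have hs : IsSimpleModule k (k ⧸ Ideal.torsionOf k K x) := by
      rw [isSimpleModule_iff_isCoatom]
      exact heq ▸ (Ideal.isMaximal_def.1 hI)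
    have : IsSimpleModule k (Submodule.span k {x}) :=
      IsSimpleModule.congr (Ideal.quotTorsionOfEquivSpanSingleton k K x).symm
    exact (le_sSup (show Submodule.span k {x} ∈ {m : Submodule k K | IsSimpleModule k m} from this))
      (Submodule.mem_span_singleton_self x)
  have hS : ∃ I : Ideal k, I.IsMaximal ∧ ∀ s : S, ∀ a ∈ I, a • s = 0 := by
    obtain ⟨I, hI, ⟨e⟩⟩ := isSimpleModule_iff_quot_maximal.1 (inferInstance : IsSimpleModule k S)
    refine ⟨I, hI, fun s a ha => e.injective ?_⟩
    obtain ⟨b, hb⟩ := Submodule.Quotient.mk_surjective _ (e s)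
    rw [map_smul, ← hb, map_zero, ← Submodule.Quotient.mk_smul, Submodule.Quotient.mk_eq_zero]
    exact I.mul_mem_right _ ha
  obtain ⟨I₀, hI₀, hSI⟩ := hS
  have hψsoc : ∀ s, ψ s ∈ soc := fun s => hmem I₀ hI₀ _ fun a ha => by
    rw [← map_smul, hSI s a ha, map_zero]
  have hφsoc : ∀ s, φ s ∈ soc := fun s => hmem I₀ hI₀ _ fun a ha => by
    rw [← map_smul, hSI s a ha, map_zero]
  -- Were `φ` and `ψ` not proportional, the socle would contain two independent copies of `S`. The
  -- endomorphism `P` of the socle deletes the copy `ψ(S)`; extended to `K` it yields, by Fitting's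
  -- lemma, a direct summand of `K` that misses `ψ(S)` but is still a cogenerator.
  let B : Submodule k soc := LinearMap.range (ψ.codRestrict soc hψsoc)
  have hB : ∀ x : soc, x ∈ B ↔ ∃ s, ψ s = x := fun x => by
    simp [B, LinearMap.mem_range, Subtype.ext_iff]
  obtain ⟨B', hBB'⟩ := exists_isCompl B
  let P : soc →ₗ[k] soc := B'.subtype ∘ₗ B'.projectionOnto B hBB'.symm
  have hPB : ∀ x, P x = 0 ↔ x ∈ B := fun x => by
    rw [LinearMap.comp_apply, Submodule.subtype_apply, ZeroMemClass.coe_eq_zero]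
    exact Submodule.projectionOnto_apply_eq_zero_iff hBB'.symm
  have hPP : ∀ x, P (P x) = P x := fun x =>
    congrArg B'.subtype (Submodule.projectionOnto_apply_left hBB'.symm _)
  obtain ⟨θ, hθ⟩ := hK.injective.out soc.subtype soc.subtype_injective (soc.subtype ∘ₗ P)
  have hθ' : ∀ x : soc, θ x = P x := hθ
  have hpow : ∀ (N : ℕ) (x : soc), (θ ^ (N + 1)) x = P x := by
    intro N x
    induction N with
    | zero => simpa using hθ' x
    | succ N ih => rw [pow_succ', Module.End.mul_apply, ih, hθ', hPP]
  obtain ⟨N, hN⟩ := Filter.eventually_atTop.1 (LinearMap.eventually_isCompl_ker_pow_range_pow θ)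
  have hcompl := hN (N + 1) (Nat.le_succ N)
  set R := LinearMap.range (θ ^ (N + 1)) with hR
  have hRinj : Module.Injective k R := injective_of_isCompl hK.injective hcompl.symm
  have hfin : Module.Finite k R := inferInstance
  have hsimple : ∀ I : Ideal k, I.IsMaximal → ∃ r : R, r ≠ 0 ∧ ∀ a ∈ I, a • r = 0 := by
    have key : ∀ I : Ideal k, I.IsMaximal → ∃ x : soc, P x ≠ 0 ∧ ∀ a ∈ I, a • x = 0 := by
      intro I hI
      have h10 : (Submodule.Quotient.mk 1 : k ⧸ I) ≠ 0 := by
        rw [Ne, Submodule.Quotient.mk_eq_zero]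
        exact fun h => hI.ne_top ((Ideal.eq_top_iff_one I).2 h)
      obtain ⟨f, hf⟩ := hK.cogenerator (k ⧸ I) _ h10
      have hIx : ∀ a ∈ I, a • f (Submodule.Quotient.mk 1) = 0 := fun a ha => by
        rw [← map_smul, ← Submodule.Quotient.mk_smul, smul_eq_mul, mul_one,
          (Submodule.Quotient.mk_eq_zero _).2 ha, map_zero]
      let x : soc := ⟨_, hmem I hI _ hIx⟩
      by_cases hPx : P x = 0
      · obtain ⟨s, hs⟩ := (hB x).1 ((hPB x).1 hPx)
        have hs' : ψ s = f (Submodule.Quotient.mk 1) := hs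
        have hs0 : s ≠ 0 := by
          rintro rfl
          exact hf (by rw [← hs', map_zero])
        have hIs : ∀ a ∈ I, a • s = 0 := fun a ha => hψi (by rw [map_smul, hs', hIx a ha, map_zero])
        -- When the given copy of `k / I` lies in `ψ(S)`, the copy in `φ(S)` survives `P` instead:
        -- `φ s ∈ ψ(S)` would make `φ` a multiple of `ψ`.
        refine ⟨⟨φ s, hφsoc s⟩, fun h => ?_, fun a ha => Subtype.ext ?_⟩
        · obtain ⟨s', hs'⟩ := (hB _).1 ((hPB _).1 h)
          obtain ⟨c, rfl⟩ := IsSimpleModule.toSpanSingleton_surjective k hs0 s'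
          refine hφ ⟨c, LinearMap.ext fun y => ?_⟩
          obtain ⟨b, rfl⟩ := IsSimpleModule.toSpanSingleton_surjective k hs0 y
          simp only [LinearMap.toSpanSingleton_apply, map_smul, LinearMap.smul_apply] at hs' ⊢
          rw [← hs', smul_comm]
        · simp [← map_smul, hIs a ha]
      · exact ⟨x, hPx, fun a ha => Subtype.ext (hIx a ha)⟩
    intro I hI
    obtain ⟨x, hx, hIx⟩ := key I hI
    refine ⟨⟨P x, x, hpow N x⟩, fun h => hx (Subtype.ext (congrArg (fun y : R => (y : K)) h)), fun a ha => ?_⟩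
    apply Subtype.ext
    change a • (P x : K) = 0
    rw [← Submodule.coe_smul, ← map_smul, hIx a ha, map_zero, Submodule.coe_zero]
  have htop := hK.minimal R
    ⟨hfin, hRinj, fun M _ _ _ m hm => exists_ne_zero_of_injective hRinj hsimple hm⟩
  have hker : LinearMap.ker (θ ^ (N + 1)) = ⊥ := by
    have := hcompl.disjoint
    rwa [htop, disjoint_top] at this
  apply hψ
  ext s
  apply LinearMap.ker_eq_bot.1 hker
  have h := hpow N ⟨ψ s, hψsoc s⟩
  rw [(hPB _).2 ((hB _).2 ⟨s, rfl⟩)] at h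
  simpa using h

/-- Induction along a composition series: `Hom(-, K)` is left exact, and the dual of a simple module
has length at most one because its nonzero elements are all proportional. -/
lemma IsMinInjCogenerator.length_dual_le [IsArtinianRing k] (hK : IsMinInjCogenerator k K)
    {M : Type w} [AddCommGroup M] [Module k M] (hM : IsFiniteLength k M) :
    Module.length k (M →ₗ[k] K) ≤ Module.length k M := by
  induction hM with
  | of_subsingleton => simp
  | @of_simple_quotient M _ _ N hN _ ih =>
    let f : ((M ⧸ N) →ₗ[k] K) →ₗ[k] (M →ₗ[k] K) := LinearMap.lcomp k K N.mkQ
    let g : (M →ₗ[k] K) →ₗ[k] (N →ₗ[k] K) := LinearMap.lcomp k K N.subtype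
    have hf : Function.Injective f := fun a b h => by
      refine LinearMap.ext fun x => ?_
      obtain ⟨y, rfl⟩ := N.mkQ_surjective x
      exact LinearMap.congr_fun h y
    have hexact : Function.Exact f g.rangeRestrict := by
      intro φ
      constructor
      · intro h
        have h' : g φ = 0 := congrArg Subtype.val h
        have hle : N ≤ LinearMap.ker φ := fun x hx => LinearMap.congr_fun h' ⟨x, hx⟩
        exact ⟨N.liftQ φ hle, N.liftQ_mkQ φ hle⟩
      · rintro ⟨a, rfl⟩
        apply Subtype.ext
        refine LinearMap.ext fun x => ?_
        exact (congrArg a ((Submodule.Quotient.mk_eq_zero N).2 x.2)).trans (map_zero a)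
    rw [Module.length_eq_add_of_exact f g.rangeRestrict hf g.surjective_rangeRestrict hexact,
      Module.length_eq_add_of_exact N.subtype N.mkQ N.subtype_injective N.mkQ_surjective
        (LinearMap.exact_subtype_mkQ N), add_comm]
    refine add_le_add ((Module.length_le_of_injective _ (Submodule.subtype_injective _)).trans ih) ?_
    rw [Module.length_eq_one k (M ⧸ N)]
    by_cases hs : Subsingleton ((M ⧸ N) →ₗ[k] K)
    · simp
    · rw [not_subsingleton_iff_nontrivial] at hs
      have : IsSimpleModule k ((M ⧸ N) →ₗ[k] K) := by
        rw [isSimpleModule_iff_toSpanSingleton_surjective]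
        refine ⟨hs, fun ψ hψ φ => ?_⟩
        obtain ⟨c, hc⟩ := hK.exists_smul_eq ψ φ hψ
        exact ⟨c, hc.symm⟩
      rw [Module.length_eq_one k]

/-- A submodule of the dual of a finitely generated module which separates points is everything. -/
lemma IsMinInjCogenerator.eq_top [IsArtinianRing k] (hK : IsMinInjCogenerator k K)
    {M : Type w} [AddCommGroup M] [Module k M] [Module.Finite k M] (U : Submodule k (M →ₗ[k] K))
    (hU : ∀ m : M, (∀ φ ∈ U, φ m = 0) → m = 0) : U = ⊤ := by
  have hM : IsFiniteLength k M := by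
    rw [isFiniteLength_iff_isNoetherian_isArtinian]
    exact ⟨inferInstance, inferInstance⟩
  have hMd := hK.length_dual_le hM
  have hD : IsFiniteLength k (M →ₗ[k] K) :=
    Module.length_ne_top_iff.1 (ne_top_of_le_ne_top (Module.length_ne_top_iff.2 hM) hMd)
  obtain ⟨_, _⟩ := isFiniteLength_iff_isNoetherian_isArtinian.1 hD
  have hUl : IsFiniteLength k U := isFiniteLength_iff_isNoetherian_isArtinian.2
    ⟨inferInstance, inferInstance⟩
  by_contra hne
  have h1 := Submodule.length_lt hne
  -- Separation of points embeds `M` in the dual of `U`, so the length of `M` is at most that of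
  -- `U`; a proper `U` would be strictly shorter than the dual of `M`, hence than `M`.
  let ev : M →ₗ[k] (U →ₗ[k] K) := (LinearMap.lcomp k K U.subtype) ∘ₗ LinearMap.applyₗ
  have hev : Function.Injective ev := by
    rw [injective_iff_map_eq_zero]
    exact fun m hm => hU m fun φ hφ => LinearMap.congr_fun hm ⟨φ, hφ⟩
  have h2 := (Module.length_le_of_injective ev hev).trans (hK.length_dual_le hUl)
  exact absurd (h1.trans_le (hMd.trans h2)) (lt_irrefl _)

end Matlis

/-! ### The radical of a Krull–Schmidt category -/

section Radical

variable {C : Type u} [Category.{v} C] [Preadditive C]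

/-- `1 - xy` is invertible as soon as `1 - yx` is. -/
lemma isIso_one_sub_comp {X Y : C} (f : X ⟶ Y) (g : Y ⟶ X) (h : IsIso (𝟙 Y - g ≫ f)) :
    IsIso (𝟙 X - f ≫ g) := by
  obtain ⟨r, h1, h2⟩ := h
  have h1' : r = 𝟙 Y + g ≫ f ≫ r := by
    rw [Preadditive.sub_comp, Category.id_comp, Category.assoc, sub_eq_iff_eq_add] at h1
    exact h1
  have h2' : r = 𝟙 Y + r ≫ g ≫ f := by
    rw [Preadditive.comp_sub, Category.comp_id, sub_eq_iff_eq_add] at h2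
    exact h2
  refine ⟨𝟙 X + f ≫ r ≫ g, ?_, ?_⟩
  · have : f ≫ g ≫ f ≫ r ≫ g = f ≫ r ≫ g - f ≫ g := by
      conv_rhs => rw [h1']
      simp
    simp [this]
  · have : f ≫ r ≫ g ≫ f ≫ g = f ≫ r ≫ g - f ≫ g := by
      conv_rhs => rw [h2']
      simp
    simp [this]

lemma InRad.isIso_left {X Y : C} {f : X ⟶ Y} (hf : InRad f) (g : Y ⟶ X) : IsIso (𝟙 Y - g ≫ f) :=
  isIso_one_sub_comp _ _ (hf g)

lemma InRad.of_left {X Y : C} {f : X ⟶ Y} (hf : ∀ g : Y ⟶ X, IsIso (𝟙 Y - g ≫ f)) : InRad f :=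
  fun g => isIso_one_sub_comp _ _ (hf g)

lemma InRad.comp_right {X Y Z : C} {f : X ⟶ Y} (hf : InRad f) (h : Y ⟶ Z) : InRad (f ≫ h) :=
  fun g => by simpa using hf (h ≫ g)

lemma InRad.comp_left {X Y Z : C} {f : X ⟶ Y} (hf : InRad f) (h : Z ⟶ X) : InRad (h ≫ f) :=
  .of_left fun g => by simpa using hf.isIso_left (g ≫ h)

lemma InRad.zero (X Y : C) : InRad (0 : X ⟶ Y) := fun g => by
  rw [zero_comp, sub_zero]
  infer_instance

lemma InRad.add {X Y : C} {f f' : X ⟶ Y} (hf : InRad f) (hf' : InRad f') : InRad (f + f') := by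
  intro g
  have := hf g
  have h2 := (hf'.comp_left (inv (𝟙 X - f ≫ g))) g
  have heq : 𝟙 X - (f + f') ≫ g =
      (𝟙 X - f ≫ g) ≫ (𝟙 X - (inv (𝟙 X - f ≫ g) ≫ f') ≫ g) := by
    rw [Preadditive.comp_sub, Category.comp_id, Category.assoc, IsIso.hom_inv_id_assoc,
      Preadditive.add_comp, sub_sub]
  rw [heq]
  infer_instance

lemma InRad.sum {ι : Type*} (s : Finset ι) {X Y : C} (f : ι → (X ⟶ Y)) (hf : ∀ i, InRad (f i)) :
    InRad (∑ i ∈ s, f i) := by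
  classical
  induction s using Finset.induction_on with
  | empty => simpa using InRad.zero X Y
  | insert a s ha ih =>
    rw [Finset.sum_insert ha]
    exact (hf a).add ih

lemma isIso_or_isIso_one_sub {X : C} (h : IsLocalRing (End X)) (f : X ⟶ X) :
    IsIso f ∨ IsIso (𝟙 X - f) :=
  (IsLocalRing.isUnit_or_isUnit_of_add_one (R := End X) (a := f) (b := 𝟙 X - f)
    (add_sub_cancel f (𝟙 X))).imp (isUnit_iff_isIso f).1 (isUnit_iff_isIso (𝟙 X - f)).1

lemma not_isZero_of_isLocalRing {X : C} (h : IsLocalRing (End X)) : ¬ IsZero X := fun hX =>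
  one_ne_zero (α := End X) (hX.eq_of_src _ _)

/-- A split monomorphism between objects with local endomorphism rings is an isomorphism. -/
lemma isIso_of_split {X Y : C} (hX : ¬ IsZero X) (hY : IsLocalRing (End Y)) (f : X ⟶ Y) (r : Y ⟶ X)
    (h : f ≫ r = 𝟙 X) : IsIso f := by
  rcases isIso_or_isIso_one_sub hY (r ≫ f) with h1 | h1
  · refine ⟨r, h, ?_⟩
    rw [← cancel_epi (r ≫ f)]
    simp [reassoc_of% h]
  · have : f = 0 := by
      rw [← cancel_mono (𝟙 Y - r ≫ f)]
      simp [reassoc_of% h]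
    rw [this, zero_comp] at h
    exact absurd ((IsZero.iff_id_eq_zero X).2 h.symm) hX

lemma inRad_of_not_isIso {X Y : C} (hX : IsLocalRing (End X)) (hY : IsLocalRing (End Y))
    (f : X ⟶ Y) (hf : ¬ IsIso f) : InRad f := by
  intro g
  refine (isIso_or_isIso_one_sub hX (f ≫ g)).resolve_left fun h => hf ?_
  exact isIso_of_split (not_isZero_of_isLocalRing hX) hY f (g ≫ inv (f ≫ g)) (by
    rw [← Category.assoc, IsIso.hom_inv_id])

variable [HasFiniteBiproducts C]

/-- `X` is a direct sum of `m` objects with local endomorphism rings. -/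
def HasSize (X : C) (m : ℕ) : Prop :=
  ∃ Z : Fin m → C, (∀ i, IsLocalRing (End (Z i))) ∧ Nonempty (X ≅ ⨁ Z)

lemma biproduct_total_fin {m : ℕ} (Z : Fin m → C) :
    ∑ a, biproduct.π Z a ≫ biproduct.ι Z a = 𝟙 (⨁ Z) := biproduct.total

/-- The complement of one summand of a direct sum. -/
lemma exists_complement {X : C} {m : ℕ} (Z : Fin (m + 1) → C) (hZ : ∀ i, IsLocalRing (End (Z i)))
    (e : X ≅ ⨁ Z) (a : Fin (m + 1)) : ∃ (X' : C) (c : X' ⟶ X) (p : X ⟶ X'), HasSize X' m ∧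
      c ≫ p = 𝟙 X' ∧
      p ≫ c = 𝟙 X - (e.hom ≫ biproduct.π Z a) ≫ biproduct.ι Z a ≫ e.inv := by
  let Z' : Fin m → C := fun i => Z (a.succAbove i)
  refine ⟨⨁ Z', biproduct.desc (fun i => biproduct.ι Z (a.succAbove i)) ≫ e.inv,
    e.hom ≫ biproduct.lift fun i => biproduct.π Z (a.succAbove i),
    ⟨Z', fun i => hZ _, ⟨Iso.refl _⟩⟩, ?_, ?_⟩
  · rw [Category.assoc, e.inv_hom_id_assoc]
    ext i j
    simp only [Category.assoc, biproduct.lift_π, biproduct.ι_desc_assoc, Category.id_comp]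
    by_cases hij : j = i
    · subst hij
      simp [Z']
    · rw [biproduct.ι_π_ne _ (fun h => hij (Fin.succAbove_right_injective h)),
        biproduct.ι_π_ne _ hij]
  · have h1 : biproduct.lift (fun i => biproduct.π Z (a.succAbove i)) ≫
        biproduct.desc (fun i => biproduct.ι Z (a.succAbove i)) =
        𝟙 _ - biproduct.π Z a ≫ biproduct.ι Z a := by
      rw [eq_sub_iff_add_eq', biproduct.lift_desc, ← biproduct_total_fin Z,
        Fin.sum_univ_succAbove _ a]
    rw [Category.assoc, reassoc_of% h1]
    simp

/-- A morphism outside the radical has an isomorphism between summands as a component. -/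
lemma exists_of_not_inRad {X Y : C} {m l : ℕ} (hX : HasSize X m) (hY : HasSize Y l) (f : X ⟶ Y)
    (hf : ¬ InRad f) : ∃ (T : C) (ι : T ⟶ X) (ρ : X ⟶ T) (κ : T ⟶ Y) (π : Y ⟶ T),
      ι ≫ f ≫ π = 𝟙 T ∧
      (∃ (X' : C) (c : X' ⟶ X) (p : X ⟶ X') (m' : ℕ), m' + 1 = m ∧ HasSize X' m' ∧
        c ≫ p = 𝟙 X' ∧ p ≫ c = 𝟙 X - ρ ≫ ι ∧ ι ≫ p = 0) ∧
      ∃ (Y' : C) (c : Y' ⟶ Y) (p : Y ⟶ Y') (l' : ℕ), l' + 1 = l ∧ HasSize Y' l' ∧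
        c ≫ p = 𝟙 Y' ∧ p ≫ c = 𝟙 Y - π ≫ κ ∧ c ≫ π = 0 := by
  obtain ⟨Z, hZ, ⟨e⟩⟩ := hX
  obtain ⟨Z', hZ', ⟨e'⟩⟩ := hY
  -- Otherwise all matrix entries of `f` are non-isomorphisms between objects with local
  -- endomorphism rings, hence radical, and so is their sum `f`.
  have hex : ∃ a b, IsIso ((biproduct.ι Z a ≫ e.inv) ≫ f ≫ e'.hom ≫ biproduct.π Z' b) := by
    by_contra! h
    apply hf
    have heq : f = ∑ a, ∑ b, (e.hom ≫ biproduct.π Z a) ≫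
        ((biproduct.ι Z a ≫ e.inv) ≫ f ≫ e'.hom ≫ biproduct.π Z' b) ≫
          biproduct.ι Z' b ≫ e'.inv := by
      have h1 : f = e.hom ≫ (∑ a, biproduct.π Z a ≫ biproduct.ι Z a) ≫ e.inv ≫ f ≫ e'.hom ≫
          (∑ b, biproduct.π Z' b ≫ biproduct.ι Z' b) ≫ e'.inv := by
        rw [biproduct_total_fin, biproduct_total_fin]
        simp
      conv_lhs => rw [h1]
      simp only [Preadditive.sum_comp, Preadditive.comp_sum, Category.assoc]
      exact Finset.sum_comm
    rw [heq]
    exact InRad.sum _ _ fun a => InRad.sum _ _ fun b =>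
      ((inRad_of_not_isIso (hZ a) (hZ' b) _ (h a b)).comp_right _).comp_left _
  obtain ⟨a, b, hab⟩ := hex
  cases m with
  | zero => exact a.elim0
  | succ m =>
  cases l with
  | zero => exact b.elim0
  | succ l =>
  obtain ⟨X', c, p, hX', hcp, hpc⟩ := exists_complement Z hZ e a
  obtain ⟨Y', c', p', hY', hcp', hpc'⟩ := exists_complement Z' hZ' e' b
  set φ := (biproduct.ι Z a ≫ e.inv) ≫ f ≫ e'.hom ≫ biproduct.π Z' b with hφ
  refine ⟨Z a, biproduct.ι Z a ≫ e.inv, e.hom ≫ biproduct.π Z a, φ ≫ biproduct.ι Z' b ≫ e'.inv,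
    (e'.hom ≫ biproduct.π Z' b) ≫ inv φ, ?_, ⟨X', c, p, m, rfl, hX', hcp, hpc, ?_⟩,
    ⟨Y', c', p', l, rfl, hY', hcp', ?_, ?_⟩⟩
  · have : (biproduct.ι Z a ≫ e.inv) ≫ f ≫ (e'.hom ≫ biproduct.π Z' b) ≫ inv φ = φ ≫ inv φ := by
      simp only [hφ, Category.assoc]
    rw [this, IsIso.hom_inv_id]
  · have h1 : (biproduct.ι Z a ≫ e.inv) ≫ p ≫ c = 0 := by
      rw [hpc]
      simp
    calc _ = ((biproduct.ι Z a ≫ e.inv) ≫ p ≫ c) ≫ p := by simp [hcp]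
      _ = 0 := by rw [h1, zero_comp]
  · rw [hpc']
    simp
  · have h1 : (p' ≫ c') ≫ e'.hom ≫ biproduct.π Z' b = 0 := by
      rw [hpc']
      simp
    calc _ = c' ≫ ((p' ≫ c') ≫ e'.hom ≫ biproduct.π Z' b) ≫ inv φ := by
          simp [reassoc_of% hcp']
      _ = 0 := by rw [h1, zero_comp, comp_zero]

/-- Every morphism has a right minimal version. -/
lemma exists_rightMinimal (hC : KrullSchmidt C) {X Y : C} (f : X ⟶ Y) :
    ∃ (X' : C) (f' : X' ⟶ Y), RightMinimal f' ∧ RightEquivalent f f' := by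
  classical
  have hex : ∃ (m : ℕ) (X' : C) (f' : X' ⟶ Y), HasSize X' m ∧ RightEquivalent f f' := by
    obtain ⟨m, hm⟩ := hC X
    exact ⟨m, X, f, hm, ⟨𝟙 X, by simp⟩, ⟨𝟙 X, by simp⟩⟩
  -- A version of `f` with the fewest summands is right minimal. If `x` fixes `f'` without being
  -- invertible, then `1 - x` is not radical; correcting the identity by `π ≫ ι ≫ (1 - x)`, which
  -- `f'` kills, pushes `f'` onto a smaller summand.
  obtain ⟨X', f', hX', ⟨a, ha⟩, b, hb⟩ := Nat.find_spec hex
  refine ⟨X', f', ?_, ⟨a, ha⟩, b, hb⟩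
  by_contra hmin
  simp only [RightMinimal, not_forall] at hmin
  obtain ⟨x, hx, hxi⟩ := hmin
  have hnr : ¬ InRad (𝟙 X' - x) := fun h => hxi (by simpa using h (𝟙 X'))
  obtain ⟨T, ι, ρ, κ, π, h1, -, Y', c, p, l, hl, hY', hcp, hpc, hcπ⟩ :=
    exists_of_not_inRad hX' hX' _ hnr
  have hxf : (𝟙 X' - x) ≫ f' = 0 := by simp [hx]
  have hc : ((𝟙 X' - π ≫ ι ≫ (𝟙 X' - x)) ≫ p) ≫ c ≫ f' = f' := by
    have h2 : (𝟙 X' - π ≫ ι ≫ (𝟙 X' - x)) ≫ p ≫ c = 𝟙 X' - π ≫ ι ≫ (𝟙 X' - x) := by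
      rw [hpc, Preadditive.comp_sub, Category.comp_id, sub_eq_self, Preadditive.sub_comp,
        Category.id_comp]
      simp only [Category.assoc]
      rw [reassoc_of% h1, sub_self]
    rw [Category.assoc, ← Category.assoc p, ← Category.assoc, h2, Preadditive.sub_comp,
      Category.id_comp, Category.assoc, Category.assoc, hxf]
    simp
  refine Nat.find_min hex (show l < Nat.find hex by omega) ⟨Y', c ≫ f', hY', 
    ⟨a ≫ (𝟙 X' - π ≫ ι ≫ (𝟙 X' - x)) ≫ p, ?_⟩, ⟨c ≫ b, by rw [Category.assoc, hb]⟩⟩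
  · rw [Category.assoc, hc, ha]

end Radical

/-! ### Extensions and the long exact sequences -/

section Bilinear

variable {k : Type t} [CommRing k] {C : Type u} [Category.{v} C]

section

variable (E : Cᵒᵖ ⥤ C ⥤ ModuleCat.{w} k)

lemma push_id_apply {A B : C} (x : Extn E B A) : push E (𝟙 A) B x = x := by simp [push]

lemma push_comp_apply {A A' A'' B : C} (a : A ⟶ A') (a' : A' ⟶ A'') (x : Extn E B A) :
    push E (a ≫ a') B x = push E a' B (push E a B x) := by simp [push]

lemma pull_id_apply {A B : C} (x : Extn E B A) : pull E (𝟙 B) A x = x := by simp [pull]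

lemma pull_comp_apply {A B B' B'' : C} (c : B' ⟶ B) (c' : B'' ⟶ B') (x : Extn E B A) :
    pull E (c' ≫ c) A x = pull E c' A (pull E c A x) := by simp [pull]

lemma push_pull {A A' B B' : C} (a : A ⟶ A') (c : B' ⟶ B) (x : Extn E B A) :
    push E a B' (pull E c A x) = pull E c A' (push E a B x) :=
  (ConcreteCategory.congr_hom ((E.map c.op).naturality a) x).symm

end

variable [Preadditive C] [Linear k C] {E : Cᵒᵖ ⥤ C ⥤ ModuleCat.{w} k}

namespace IsBilinear

variable (hE : IsBilinear E)
include hE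

lemma push_zero (A A' B : C) : push E (0 : A ⟶ A') B = 0 := by
  simpa using hE.push_smul (0 : k) (0 : A ⟶ A') B

lemma pull_zero (A B B' : C) : pull E (0 : B' ⟶ B) A = 0 := by
  simpa using hE.pull_smul (0 : k) (0 : B' ⟶ B) A

lemma push_neg {A A' : C} (a : A ⟶ A') (B : C) : push E (-a) B = -push E a B := by
  simpa using hE.push_smul (-1 : k) a B

lemma pull_neg {B B' : C} (c : B' ⟶ B) (A : C) : pull E (-c) A = -pull E c A := by
  simpa using hE.pull_smul (-1 : k) c A

lemma push_sub {A A' : C} (a a' : A ⟶ A') (B : C) :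
    push E (a - a') B = push E a B - push E a' B := by
  rw [sub_eq_add_neg, hE.push_add, hE.push_neg, sub_eq_add_neg]

lemma pull_sub {B B' : C} (c c' : B' ⟶ B) (A : C) :
    pull E (c - c') A = pull E c A - pull E c' A := by
  rw [sub_eq_add_neg, hE.pull_add, hE.pull_neg, sub_eq_add_neg]

lemma push_sum {ι : Type*} (s : Finset ι) {A A' : C} (a : ι → (A ⟶ A')) (B : C) :
    push E (∑ i ∈ s, a i) B = ∑ i ∈ s, push E (a i) B := by
  classical
  induction s using Finset.induction_on with
  | empty => simpa using hE.push_zero A A' B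
  | insert i s hi ih => rw [Finset.sum_insert hi, Finset.sum_insert hi, hE.push_add, ih]

lemma pull_sum {ι : Type*} (s : Finset ι) {B B' : C} (c : ι → (B' ⟶ B)) (A : C) :
    pull E (∑ i ∈ s, c i) A = ∑ i ∈ s, pull E (c i) A := by
  classical
  induction s using Finset.induction_on with
  | empty => simpa using hE.pull_zero A B B'
  | insert i s hi ih => rw [Finset.sum_insert hi, Finset.sum_insert hi, hE.pull_add, ih]

end IsBilinear

end Bilinear

section LongExact

variable {k : Type t} [CommRing k] {C : Type u} [Category.{v} C] [Preadditive C] [Linear k C]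
  [HasFiniteBiproducts C] {n : ℕ} (S : NExangulated.{t, w} k C n)

/-- Exactness of `C(A, T) ⟶ 𝔼(B, T) ⟶ 𝔼(Xₙ, T)`. -/
lemma NExangulated.exists_push_eq (hn : 1 ≤ n) {A B T : C} {σ : Extn S.E B A}
    {X : EndedComplex n A B} (hX : S.Real σ X) (ε : Extn S.E B T)
    (hε : pull S.E X.last T ε = 0) : ∃ a : A ⟶ T, push S.E a B σ = ε := by
  have hE := S.bilinear
  let ρ : Extn S.E B (A ⊞ T) := push S.E biprod.inl B σ + push S.E biprod.inr B ε
  have hρ : push S.E biprod.fst B ρ = σ := by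
    simp only [ρ, map_add, ← push_comp_apply]
    simp [push_id_apply, hE.push_zero]
  obtain ⟨W, hW⟩ := S.exists_real ρ
  -- The cocone of the lift of the projection realizes the pullback of `ρ = (σ, ε)` along the last
  -- morphism of `X`. This is zero, so the first morphism of `N` has a retraction `r`.
  obtain ⟨h, ⟨hl, -⟩, N, ⟨φ, hφ, -, -⟩, hN⟩ := S.good_lift_op ρ biprod.fst W X hW (hρ.symm ▸ hX)
  have h0 : pull S.E X.last (A ⊞ T) ρ = 0 := by
    simp only [ρ, map_add, ← push_pull, hε, (S.isExangle _ _ hX).last_pull, map_zero, add_zero]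
  rw [h0] at hN
  obtain ⟨r, hr⟩ := (S.isExangle _ _ hN).contravariant_end _ (𝟙 _) (map_zero _)
  have hfirst := hφ hn
  rw [← Iso.eq_comp_inv] at hfirst
  have hl' : W.left.inv ≫ h.f 0 = biprod.fst ≫ X.left.inv := by
    rw [Iso.inv_comp_eq, ← Category.assoc, Iso.eq_comp_inv, hl]
  -- The component of `r` on the first inner term of `W`, projected to `T`. The composite of the
  -- first morphism of `W` with `y` kills `ρ` and is the identity on `T`, so its restriction to `A`
  -- carries `σ` to `-ε`.
  let y := biprod.inl ≫ (φ 1 0 rfl hn).inv ≫ r ≫ biprod.snd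
  have hy : biprod.inr ≫ W.first ≫ y = 𝟙 T := by
    have h1 : W.first ≫ biprod.inl ≫ (φ 1 0 rfl hn).inv ≫ r +
        biprod.fst ≫ X.left.inv ≫ biprod.inr ≫ (φ 1 0 rfl hn).inv ≫ r = 𝟙 _ := by
      rw [← hr, hfirst, biprod.lift_eq]
      simp only [EndedComplex.first, Preadditive.add_comp, Preadditive.comp_add, Category.assoc]
      rw [reassoc_of% hl']
    have h2 := congrArg (fun z => biprod.inr ≫ z ≫ biprod.snd) h1
    simpa [y] using h2
  have hzero : push S.E (W.first ≫ y) B ρ = 0 := by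
    rw [push_comp_apply, (S.isExangle _ _ hW).first_push, map_zero]
  refine ⟨-(biprod.inl ≫ W.first ≫ y), ?_⟩
  simp only [ρ, map_add, ← push_comp_apply, hy, push_id_apply] at hzero
  rw [hE.push_neg, LinearMap.neg_apply]
  exact neg_eq_of_add_eq_zero_right hzero

/-- Exactness of `C(T, B) ⟶ 𝔼(T, A) ⟶ 𝔼(T, X₁)`. -/
lemma NExangulated.exists_pull_eq (hn : 1 ≤ n) {A B T : C} {σ : Extn S.E B A}
    {X : EndedComplex n A B} (hX : S.Real σ X) (ε : Extn S.E T A)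
    (hε : push S.E X.first T ε = 0) : ∃ c : T ⟶ B, pull S.E c A σ = ε := by
  have hE := S.bilinear
  let ρ : Extn S.E (B ⊞ T) A := pull S.E biprod.fst A σ + pull S.E biprod.snd A ε
  have hρ : pull S.E biprod.inl A ρ = σ := by
    simp only [ρ, map_add, ← pull_comp_apply]
    simp [pull_id_apply, hE.pull_zero]
  obtain ⟨W, hW⟩ := S.exists_real ρ
  -- Dually, the cone realizes a zero extension, so its last morphism has a section `s`.
  obtain ⟨f, ⟨-, hr⟩, M, ⟨φ, -, hφ, hφr⟩, hM⟩ := S.good_lift ρ biprod.inl X W (hρ.symm ▸ hX) hW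
  have h0 : push S.E X.first (B ⊞ T) ρ = 0 := by
    simp only [ρ, map_add, push_pull, hε, (S.isExangle _ _ hX).first_push, map_zero, add_zero]
  rw [h0] at hM
  obtain ⟨s, hs⟩ := (S.isExangle _ _ hM).covariant_end _ (𝟙 _) (map_zero _)
  obtain ⟨m, rfl⟩ : ∃ m, n = m + 1 := ⟨n - 1, by omega⟩
  let y := biprod.inr ≫ s ≫ (φ m).hom ≫ biprod.snd
  have hy : y ≫ W.last ≫ biprod.snd = 𝟙 T := by
    have h1 : s ≫ (φ m).hom ≫ biprod.fst ≫ X.right.hom ≫ biprod.inl +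
        s ≫ (φ m).hom ≫ biprod.snd ≫ W.last = 𝟙 _ := by
      have hlast : M.last = M.cpx.d (m + 1) (m + 2) ≫ (φ (m + 1)).hom ≫ biprod.snd ≫
          W.right.hom := by
        rw [EndedComplex.last, hφr]
      rw [← hs, hlast, ← hr]
      simp [reassoc_of% (hφ m), EndedComplex.last, Biprod.ofComponents]
    have h2 := congrArg (fun z => biprod.inr ≫ z ≫ biprod.snd) h1
    simpa [y] using h2
  have hzero : pull S.E (y ≫ W.last) A ρ = 0 := by
    rw [pull_comp_apply, (S.isExangle _ _ hW).last_pull, map_zero]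
  refine ⟨-((y ≫ W.last) ≫ biprod.fst), ?_⟩
  have hy' : (y ≫ W.last) ≫ biprod.snd = 𝟙 T := by rw [Category.assoc, hy]
  simp only [ρ, map_add, ← pull_comp_apply, hy', pull_id_apply] at hzero
  rw [hE.pull_neg, LinearMap.neg_apply]
  exact neg_eq_of_add_eq_zero_right hzero

/-- A morphism factors through the last morphism iff it kills the extension. -/
lemma NExangulated.pull_eq_zero_iff {A B : C} {σ : Extn S.E B A}
    {X : EndedComplex n A B} (hX : S.Real σ X) {T : C} (g : T ⟶ B) :
    pull S.E g A σ = 0 ↔ ∃ s : T ⟶ X.cpx.X n, s ≫ X.last = g := by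
  refine ⟨(S.isExangle _ _ hX).covariant_end T g, ?_⟩
  rintro ⟨s, rfl⟩
  rw [pull_comp_apply, (S.isExangle _ _ hX).last_pull, map_zero]

/-- A morphism factors through the first morphism iff it kills the extension. -/
lemma NExangulated.push_eq_zero_iff {A B : C} {σ : Extn S.E B A}
    {X : EndedComplex n A B} (hX : S.Real σ X) {T : C} (g : A ⟶ T) :
    push S.E g B σ = 0 ↔ ∃ s : X.cpx.X 1 ⟶ T, X.first ≫ s = g := by
  refine ⟨(S.isExangle _ _ hX).contravariant_end T g, ?_⟩
  rintro ⟨s, rfl⟩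
  rw [push_comp_apply, (S.isExangle _ _ hX).first_push, map_zero]

end LongExact

/-! ### Splitting off contractible summands -/

section Splitting

variable {C : Type u} [Category.{v} C] [Preadditive C]

/-- The direct summand of a complex cut out by an idempotent `ε` which splits in each degree. -/
def splitComplex {U : CochainComplex C ℕ} (ε : U ⟶ U) {X' : ℕ → C} (s : ∀ j, X' j ⟶ U.X j)
    (r : ∀ j, U.X j ⟶ X' j) (rs : ∀ j, r j ≫ s j = ε.f j) : CochainComplex C ℕ where
  X := X'
  d i j := s i ≫ U.d i j ≫ r j
  shape i j hij := by simp [U.shape i j hij]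
  d_comp_d' i j l _ _ := by
    simp only [Category.assoc]
    rw [reassoc_of% (rs j), ε.comm_assoc, U.d_comp_d_assoc]
    simp

variable {U : CochainComplex C ℕ} {ε : U ⟶ U} {X' : ℕ → C} {s : ∀ j, X' j ⟶ U.X j}
    {r : ∀ j, U.X j ⟶ X' j} (sr : ∀ j, s j ≫ r j = 𝟙 _) (rs : ∀ j, r j ≫ s j = ε.f j)

include sr in
lemma comp_split (j : ℕ) (rs : r j ≫ s j = ε.f j) : s j ≫ ε.f j = s j := by
  rw [← rs, reassoc_of% (sr j)]

include sr in
lemma split_comp (j : ℕ) (rs : r j ≫ s j = ε.f j) : ε.f j ≫ r j = r j := by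
  rw [← rs, Category.assoc, sr, Category.comp_id]

include sr

/-- The inclusion of `splitComplex`. -/
def splitIncl : splitComplex ε s r rs ⟶ U where
  f := s
  comm' i j _ := by
    have h : (s i ≫ U.d i j ≫ r j) ≫ s j = s i ≫ U.d i j := by
      rw [Category.assoc, Category.assoc, rs, ← ε.comm, ← Category.assoc, comp_split sr i (rs i)]
    exact h.symm

/-- The projection onto `splitComplex`. -/
def splitProj : U ⟶ splitComplex ε s r rs where
  f := r
  comm' i j _ := by
    have h : r i ≫ s i ≫ U.d i j ≫ r j = U.d i j ≫ r j := by
      rw [reassoc_of% (rs i), ε.comm_assoc, split_comp sr j (rs j)]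
    exact h

end Splitting

namespace EndedComplex

variable {C : Type u} [Category.{v} C] [Preadditive C] {n : ℕ} {A B : C}

/-- The inclusion and projection of the summand are inverse up to the homotopy from `ε` to the
identity. Since `ε` is the identity at both ends, the ends are preserved. -/
lemma exists_split (W : EndedComplex n A B) {ε : W.cpx ⟶ W.cpx} (e : Homotopy ε (𝟙 W.cpx))
    {X' : ℕ → C} {s : ∀ j, X' j ⟶ W.cpx.X j} {r : ∀ j, W.cpx.X j ⟶ X' j}
    (sr : ∀ j, s j ≫ r j = 𝟙 _) (rs : ∀ j, r j ≫ s j = ε.f j) (h0 : ε.f 0 = 𝟙 _)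
    (h1 : ε.f (n + 1) = 𝟙 _) : ∃ W' : EndedComplex n A B, W'.cpx.X = X' ∧ W.HtpyEquiv W' := by
  let W' : EndedComplex n A B :=
    { cpx := splitComplex ε s r rs
      isZero := fun i hi => by
        have h := W.isZero i hi
        rw [IsZero.iff_id_eq_zero]
        change 𝟙 (X' i) = 0
        rw [← sr i, h.eq_of_src (r i) 0, comp_zero]
      left := ⟨s 0, r 0, sr 0, (rs 0).trans h0⟩ ≪≫ W.left
      right := ⟨s (n + 1), r (n + 1), sr (n + 1), (rs (n + 1)).trans h1⟩ ≪≫ W.right }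
  refine ⟨W', rfl, splitProj sr rs, splitIncl sr rs, ⟨?_, ?_⟩, ⟨?_, ?_⟩, ⟨?_⟩, ⟨?_⟩⟩
  · change r 0 ≫ s 0 ≫ W.left.hom = _
    rw [← Category.assoc, rs, h0, Category.id_comp, Category.comp_id]
  · change r (n + 1) ≫ s (n + 1) ≫ W.right.hom = _
    rw [← Category.assoc, rs, h1, Category.id_comp, Category.comp_id]
  · change s 0 ≫ W.left.hom = (s 0 ≫ W.left.hom) ≫ 𝟙 A
    rw [Category.comp_id]
  · change s (n + 1) ≫ W.right.hom = (s (n + 1) ≫ W.right.hom) ≫ 𝟙 B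
    rw [Category.comp_id]
  · refine (Homotopy.ofEq ?_).trans e
    ext j
    exact rs j
  · refine Homotopy.ofEq ?_
    ext j
    exact sr j

variable [HasFiniteBiproducts C]

/-- If an inner differential is not in the radical, a contractible summand splits off. -/
lemma exists_reduced (W : EndedComplex n A B) {σ : ℕ → ℕ} (hσ : ∀ j, HasSize (W.cpx.X j) (σ j))
    {i : ℕ} (hi : 1 ≤ i) (hin : i < n) (hd : ¬ InRad (W.cpx.d i (i + 1))) :
    ∃ W' : EndedComplex n A B, W.HtpyEquiv W' ∧ ∃ σ' : ℕ → ℕ,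
      (∀ j, HasSize (W'.cpx.X j) (σ' j)) ∧ (∀ j, σ' j ≤ σ j) ∧ σ' i < σ i := by
  obtain ⟨T, ι, ρ, κ, π, h1, ⟨Y, c, p, l, hl, hY, hcp, hpc, hιp⟩,
    Y', c', p', l', hl', hY', hcp', hpc', hcπ'⟩ := exists_of_not_inRad (hσ i) (hσ (i + 1)) _ hd
  -- The contracting homotopy has the single nonzero component `π ≫ ι` from degree `i + 1` to degree
  -- `i`. Subtracting its boundary from the identity removes `T` from these two degrees only, and `1
  -- ≤ i < n` keeps both away from the ends.
  let hom : ∀ a b : ℕ, (ComplexShape.up ℕ).Rel b a → (W.cpx.X a ⟶ W.cpx.X b) := fun a b hab =>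
    if hb : b = i then
      eqToHom (congrArg W.cpx.X (show a = i + 1 by rw [← hb]; exact hab.symm)) ≫ π ≫ ι ≫
        eqToHom (congrArg W.cpx.X hb.symm)
    else 0
  have hom_pos : hom (i + 1) i rfl = π ≫ ι := by simp [hom]
  have hom_neg : ∀ a b hab, b ≠ i → hom a b hab = 0 := fun a b hab hb => dif_neg hb
  let ε : W.cpx ⟶ W.cpx := 𝟙 _ - Homotopy.nullHomotopicMap' hom
  have e : Homotopy ε (𝟙 W.cpx) :=
    (Homotopy.equivSubZero.symm
      ((Homotopy.ofEq (sub_sub_cancel _ _)).trans (Homotopy.nullHomotopy' hom))).symm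
  have hεf : ∀ j, ε.f j = 𝟙 _ - (Homotopy.nullHomotopicMap' hom).f j := fun j => by simp [ε]
  have hε0 : ε.f 0 = 𝟙 _ := by
    rw [hεf, Homotopy.nullHomotopicMap'_f_of_not_rel_right (k₁ := 0) (k₀ := 1) rfl
      (fun l h => by simp at h), hom_neg 1 0 rfl (by omega), comp_zero, sub_zero]
  have hεs : ∀ j, ε.f (j + 1) = 𝟙 _ - (W.cpx.d (j + 1) (j + 2) ≫ hom (j + 2) (j + 1) rfl +
      hom (j + 1) j rfl ≫ W.cpx.d j (j + 1)) := fun j => by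
    rw [hεf, Homotopy.nullHomotopicMap'_f (k₂ := j) (k₁ := j + 1) (k₀ := j + 2) rfl rfl]
  have hεi : ε.f i = 𝟙 _ - W.cpx.d i (i + 1) ≫ π ≫ ι := by
    obtain ⟨j, rfl⟩ : ∃ j, i = j + 1 := ⟨i - 1, by omega⟩
    rw [hεs, hom_neg (j + 1) j rfl (by omega), zero_comp, add_zero, ← hom_pos]
  have hεi' : ε.f (i + 1) = 𝟙 _ - (π ≫ ι) ≫ W.cpx.d i (i + 1) := by
    rw [hεs, hom_neg (i + 2) (i + 1) rfl (by omega), comp_zero, zero_add, ← hom_pos]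
  have hεj : ∀ j, j ≠ i → j ≠ i + 1 → ε.f j = 𝟙 _ := fun j hj hj' => by
    cases j with
    | zero => exact hε0
    | succ j =>
      rw [hεs, hom_neg (j + 2) (j + 1) rfl hj, hom_neg (j + 1) j rfl (by omega), comp_zero, zero_comp,
        add_zero, sub_zero]
  have key : ∀ j, ∃ (X' : C) (s : X' ⟶ W.cpx.X j) (r : W.cpx.X j ⟶ X') (m : ℕ),
      HasSize X' m ∧ m ≤ σ j ∧ (j = i → m < σ j) ∧ s ≫ r = 𝟙 _ ∧ r ≫ s = ε.f j := by
    intro j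
    by_cases hj : j = i
    · subst hj
      refine ⟨Y, c ≫ (𝟙 _ - W.cpx.d j (j + 1) ≫ π ≫ ι), p, l, hY, by omega, by omega, ?_, ?_⟩
      · rw [Category.assoc, Preadditive.sub_comp]
        simp [hιp, hcp]
      · rw [← Category.assoc, hpc, hεi, Preadditive.sub_comp, Category.id_comp, sub_eq_self,
          Preadditive.comp_sub, Category.comp_id, Category.assoc, reassoc_of% h1, sub_self]
    · by_cases hj' : j = i + 1
      · subst hj'
        refine ⟨Y', c', (𝟙 _ - (π ≫ ι) ≫ W.cpx.d i (i + 1)) ≫ p', l', hY', by omega, by omega,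
          ?_, ?_⟩
        · rw [← Category.assoc, Preadditive.comp_sub, Category.comp_id]
          simp [reassoc_of% hcπ', hcp']
        · rw [Category.assoc, hpc', hεi', Preadditive.comp_sub, Category.comp_id, sub_eq_self,
            Preadditive.sub_comp, Category.id_comp]
          simp [reassoc_of% h1]
      · exact ⟨W.cpx.X j, 𝟙 _, 𝟙 _, σ j, hσ j, le_rfl, fun h => absurd h hj, by simp,
          by rw [hεj j hj hj', Category.comp_id]⟩
  choose X' s r σ' hσ' hle hlt sr rs using key
  obtain ⟨W', hX', hW'⟩ := W.exists_split e sr rs hε0 (hεj _ (by omega) (by omega))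
  exact ⟨W', hW', σ', fun j => hX' ▸ hσ' j, hle, hlt i rfl⟩

end EndedComplex

/-! ### Existence of minimal intrinsic weak kernels -/

section EndedRadical

variable {C : Type u} [Category.{v} C] [Preadditive C] {n : ℕ}

/-- Since `d ≫ d = 0`, the endomorphism `1 - g ≫ d` fixes the last morphism. -/
lemma RightMinimal.inRad {m : ℕ} {A B : C} {X : EndedComplex (m + 1) A B}
    (h : RightMinimal X.last) : InRad (X.cpx.d m (m + 1)) := by
  refine .of_left fun g => h _ ?_
  simp [EndedComplex.last, Preadditive.sub_comp]

lemma EndedComplex.inRad_zero {A B : C} {X : EndedComplex n A B} (h : InRad X.first) :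
    InRad (X.cpx.d 0 1) := by
  have : X.cpx.d 0 1 = X.left.hom ≫ X.first := by simp [EndedComplex.first]
  rw [this]
  exact h.comp_left _

lemma EndedComplex.inRad_first {A B : C} {X : EndedComplex n A B} (h : InRad (X.cpx.d 0 1)) :
    InRad X.first :=
  h.comp_left _

end EndedRadical

section Existence

variable {k : Type t} [CommRing k] {C : Type u} [Category.{v} C] [Preadditive C] [Linear k C]
  [HasFiniteBiproducts C] {n : ℕ} (S : NExangulated.{t, w} k C n)

/-- If `a` fixes the last morphism, exactness factors `1 - a` through the preceding differential,
which is radical; so `a` is invertible. -/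
lemma RightMinimal.of_inRad {m : ℕ} {S : NExangulated.{t, w} k C (m + 1)} {A B : C}
    {σ : Extn S.E B A} {X : EndedComplex (m + 1) A B} (hX : S.Real σ X)
    (h : InRad (X.cpx.d m (m + 1))) : RightMinimal X.last := by
  intro a ha
  have h0 : (𝟙 _ - a) ≫ X.cpx.d (m + 1) (m + 2) = 0 := by
    have h1 : ((𝟙 _ - a) ≫ X.cpx.d (m + 1) (m + 2)) ≫ X.right.hom = 0 := by
      rw [Category.assoc, Preadditive.sub_comp, Category.id_comp, sub_eq_zero]
      exact ha.symm
    rwa [← cancel_mono X.right.hom, zero_comp]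
  obtain ⟨s, hs⟩ := (S.isExangle _ _ hX).covariant _ m (Nat.lt_succ_self m) _ h0
  have := h.isIso_left s
  rwa [hs, sub_sub_cancel] at this

/-- If `A ⟶ X₁` is not in the radical, a summand of `A` can be removed from the extension. -/
lemma NExangulated.exists_smaller (hC : KrullSchmidt C) {A B : C} {m : ℕ} (hA : HasSize A m)
    {σ : Extn S.E B A} {X : EndedComplex n A B} (hX : S.Real σ X) (h : ¬ InRad X.first) :
    ∃ (A' : C) (m' : ℕ) (σ' : Extn S.E B A'), m' < m ∧ HasSize A' m' ∧
      ∀ {T : C} (g : T ⟶ B), pull S.E g A' σ' = 0 ↔ pull S.E g A σ = 0 := by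
  obtain ⟨l, hl⟩ := hC (X.cpx.X 1)
  obtain ⟨T, ι, ρ, κ, π, h1, ⟨A', c, p, m', hm', hA', hcp, hpc, hιp⟩, -⟩ :=
    exists_of_not_inRad hA hl _ h
  -- `y` fixes `σ`, because the first morphism kills `σ`, and it factors through the complement of
  -- `T`. Hence passing to `p_*σ` loses no information.
  let y : A ⟶ A := 𝟙 A - X.first ≫ π ≫ ι
  have hy : push S.E y B σ = σ := by
    rw [S.bilinear.push_sub, LinearMap.sub_apply, push_id_apply, push_comp_apply,
      (S.isExangle _ _ hX).first_push, map_zero, sub_zero]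
  have hpcy : p ≫ c ≫ y = y := by
    rw [← Category.assoc, hpc, Preadditive.sub_comp, Category.id_comp, sub_eq_self]
    simp [y, reassoc_of% h1]
  refine ⟨A', m', push S.E p B σ, by omega, hA', fun g => ⟨fun hg => ?_, fun hg => ?_⟩⟩
  · rw [← hy, ← hpcy, push_comp_apply, ← push_pull, hg, map_zero]
  · rw [← push_pull, hg, map_zero]

theorem NExangulated.exists_isMinimalIntrinsicWeakKernel (hC : KrullSchmidt C) (hn : 1 ≤ n)
    (hwic : S.WIC) {X Y : C} (α : X ⟶ Y) (hα : S.IsDeflation α) :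
    ∃ Z : C, S.IsMinimalIntrinsicWeakKernel α Z := by
  classical
  by_cases hn1 : n = 1
  · subst hn1
    obtain ⟨X', f, hf, ⟨a, ha⟩, b, hb⟩ := exists_rightMinimal hC α
    obtain ⟨A, δ, U, hU, e, he⟩ := hwic.deflation a f (ha.symm ▸ hα)
    have hlast : RightMinimal U.last := by
      intro x hx
      have h2 : (e.inv ≫ x ≫ e.hom) ≫ f = f := by
        simp only [Category.assoc]
        rw [he, hx, ← he, e.inv_hom_id_assoc]
      have h3 := hf _ h2
      have h4 : x = e.hom ≫ (e.inv ≫ x ≫ e.hom) ≫ e.inv := by simp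
      rw [h4]
      infer_instance
    refine ⟨A, δ, U, hU, hlast, ⟨⟨e.hom ≫ b, by rw [Category.assoc, hb, he]⟩,
      ⟨a ≫ e.inv, by rw [← he, Category.assoc, e.inv_hom_id_assoc, ha]⟩⟩, fun i hi => ?_⟩
    obtain rfl : i = 0 := by omega
    exact hlast.inRad
  · obtain ⟨m, rfl⟩ : ∃ m, n = m + 2 := ⟨n - 2, by omega⟩
    -- The condition on `δ` makes the last morphism of any realization right equivalent to `α`,
    -- while leaving `A` free to shrink.
    have hex : ∃ (l : ℕ) (A : C) (δ : Extn S.E Y A), HasSize A l ∧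
        ∀ {T : C} (g : T ⟶ Y), pull S.E g A δ = 0 ↔ ∃ s, s ≫ α = g := by
      obtain ⟨A, δ, U, hU, e, he⟩ := hα
      obtain ⟨l, hl⟩ := hC A
      refine ⟨l, A, δ, hl, fun g => ?_⟩
      rw [S.pull_eq_zero_iff hU]
      constructor
      · rintro ⟨s, hs⟩
        exact ⟨s ≫ e.hom, by rw [Category.assoc, he, hs]⟩
      · rintro ⟨s, hs⟩
        exact ⟨s ≫ e.inv, by rw [← he, Category.assoc, e.inv_hom_id_assoc, hs]⟩
    obtain ⟨A, δ, hA, hδ⟩ := Nat.find_spec hex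
    have hfirst : ∀ U : EndedComplex (m + 2) A Y, S.Real δ U → InRad U.first := by
      intro U hU
      by_contra hr
      obtain ⟨A', l', σ', hl', hA', hσ'⟩ := S.exists_smaller hC hA hU hr
      exact Nat.find_min hex hl' ⟨A', σ', hA', fun g => (hσ' g).trans (hδ g)⟩
    have hex2 : ∃ (l : ℕ) (U : EndedComplex (m + 2) A Y) (σ : ℕ → ℕ), S.Real δ U ∧
        (∀ j, HasSize (U.cpx.X j) (σ j)) ∧ ∑ j ∈ Finset.range (m + 2), σ j = l := by
      obtain ⟨U, hU⟩ := S.exists_real δ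
      choose σ hσ using fun j => hC (U.cpx.X j)
      exact ⟨_, U, σ, hU, hσ, rfl⟩
    obtain ⟨U, σ, hU, hσ, hsum⟩ := Nat.find_spec hex2
    have hrad : ∀ i, i < m + 2 → InRad (U.cpx.d i (i + 1)) := by
      intro i hi
      by_cases hi0 : i = 0
      · subst hi0
        exact EndedComplex.inRad_zero (hfirst U hU)
      · by_contra hr
        obtain ⟨U', hUU', σ', hσ', hle, hlt⟩ := U.exists_reduced hσ (by omega) hi hr
        refine Nat.find_min hex2 ?_ ⟨U', σ', (S.real_iff δ U U' hU).2 hUU', hσ', rfl⟩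
        rw [← hsum]
        exact Finset.sum_lt_sum (fun j _ => hle j) ⟨i, Finset.mem_range.2 hi, hlt⟩
    refine ⟨A, δ, U, hU, .of_inRad hU (hrad (m + 1) (by omega)), ⟨?_, ?_⟩, hrad⟩
    · exact (hδ _).1 (S.isExangle _ _ hU).last_pull
    · exact (S.pull_eq_zero_iff hU α).1 ((hδ α).2 ⟨𝟙 X, Category.id_comp α⟩)

end Existence

/-! ### Representability of `D𝔼(-, X)` -/

section Representability

variable {k : Type t} [CommRing k] {K : Type t} [AddCommGroup K] [Module k K]
  {C : Type u} [Category.{v} C] [Preadditive C] [Linear k C]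

/-- The form `η` on `𝔼(W, X)` is a universal element of the functor `Hom_k(𝔼(-, X), K)` on the
stable category. -/
structure IsUniversalForm (E : Cᵒᵖ ⥤ C ⥤ ModuleCat.{w} k) {X W : C}
    (η : Extn E W X →ₗ[k] K) : Prop where
  exists_eq : ∀ (L : C) (φ : Extn E L X →ₗ[k] K), ∃ h : W ⟶ L, η ∘ₗ pull E h X = φ
  projTrivial : ∀ (L : C) (h : W ⟶ L), η ∘ₗ pull E h X = 0 → ProjTrivial E h

variable [HasFiniteBiproducts C] {n : ℕ} (S : NExangulated.{t, w} k C n)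

/-- Yoneda: `η` corresponds to the identity of `W`, and stable morphisms lift to `C`. -/
lemma NExangulated.exists_form_of_inCl {X : C} (h : S.InCl K X) :
    ∃ (W : C) (η : Extn S.E W X →ₗ[k] K), ∀ (L : C) (φ : Extn S.E L X →ₗ[k] K),
      ∃ h : W ⟶ L, η ∘ₗ pull S.E h X = φ := by
  obtain ⟨⟨W⟩, ⟨R⟩⟩ := h
  refine ⟨W, R.homEquiv (𝟙 _), fun L φ => ?_⟩
  obtain ⟨h, hh⟩ := (CategoryTheory.Quotient.functor (stableRel S.E)).map_surjective
    ((R.homEquiv (Y := (CategoryTheory.Quotient.functor (stableRel S.E)).obj L)).symm φ)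
  refine ⟨h, ?_⟩
  exact (R.homEquiv_eq _).symm.trans ((congrArg R.homEquiv hh).trans (Equiv.apply_symm_apply _ _))

lemma NExangulated.inCl_of_isUniversalForm {X W : C} {η : Extn S.E W X →ₗ[k] K}
    (h : IsUniversalForm S.E η) : S.InCl K X := by
  let F := stableDualExt K S.bilinear X ⋙ forget (ModuleCat k)
  let Q := CategoryTheory.Quotient.functor (stableRel S.E)
  have hF : ∀ (L : C) (f : W ⟶ L), F.map (Q.map f) η = η ∘ₗ pull S.E f X := fun L f => rfl
  refine ⟨Q.obj W, ⟨{ homEquiv := fun {Y} => Equiv.ofBijective (fun f => F.map f η) ⟨?_, ?_⟩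
                      homEquiv_comp := fun g f => ?_ }⟩⟩
  · obtain ⟨L⟩ := Y
    intro f g hfg
    obtain ⟨f, rfl⟩ := Q.map_surjective f
    obtain ⟨g, rfl⟩ := Q.map_surjective g
    have h1 : η ∘ₗ pull S.E f X = η ∘ₗ pull S.E g X := hfg
    apply CategoryTheory.Quotient.sound
    apply h.projTrivial
    rw [S.bilinear.pull_sub, LinearMap.comp_sub, h1, sub_self]
  · obtain ⟨L⟩ := Y
    intro φ
    obtain ⟨f, hf⟩ := h.exists_eq L φ
    exact ⟨Q.map f, hf⟩
  · exact congrArg (fun y => y η) (F.map_comp f g)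

/-- Universal forms on the summands add up to a universal form on a direct sum. -/
lemma IsUniversalForm.of_biproduct {E : Cᵒᵖ ⥤ C ⥤ ModuleCat.{w} k} (hE : IsBilinear E) {m : ℕ}
    {X : C} {Z W : Fin m → C} (e : X ≅ ⨁ Z) {η : ∀ i, Extn E (W i) (Z i) →ₗ[k] K}
    (h : ∀ i, IsUniversalForm E (η i)) :
    IsUniversalForm (W := ⨁ W) E
      (∑ i, η i ∘ₗ pull E (biproduct.ι W i) (Z i) ∘ₗ push E (e.hom ≫ biproduct.π Z i) (⨁ W)) := by
  have hsum : ∀ (L : C) (f : ⨁ W ⟶ L) (x : Extn E L X),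
      (∑ i, η i ∘ₗ pull E (biproduct.ι W i) (Z i) ∘ₗ push E (e.hom ≫ biproduct.π Z i) (⨁ W))
        (pull E f X x) = ∑ i, η i (pull E (biproduct.ι W i ≫ f) (Z i)
          (push E (e.hom ≫ biproduct.π Z i) L x)) := by
    intro L f x
    simp only [LinearMap.sum_apply, LinearMap.comp_apply]
    exact Finset.sum_congr rfl fun i _ => by rw [push_pull, pull_comp_apply]
  constructor
  · intro L φ
    choose f hf using fun i => (h i).exists_eq L (φ ∘ₗ push E (biproduct.ι Z i ≫ e.inv) L)
    refine ⟨biproduct.desc f, LinearMap.ext fun x => ?_⟩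
    rw [LinearMap.comp_apply, hsum]
    have hx : x = ∑ i, push E (biproduct.ι Z i ≫ e.inv) L
        (push E (e.hom ≫ biproduct.π Z i) L x) := by
      have h1 : ∑ i, (e.hom ≫ biproduct.π Z i) ≫ biproduct.ι Z i ≫ e.inv = 𝟙 X := by
        have h2 : e.hom ≫ (∑ i, biproduct.π Z i ≫ biproduct.ι Z i) ≫ e.inv = 𝟙 X := by
          rw [biproduct_total_fin]
          simp
        rw [← h2]
        simp only [Preadditive.sum_comp, Preadditive.comp_sum, Category.assoc]
      simp only [← push_comp_apply]
      rw [← LinearMap.sum_apply, ← hE.push_sum, h1, push_id_apply]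
    conv_rhs => rw [hx, map_sum]
    refine Finset.sum_congr rfl fun i _ => ?_
    rw [biproduct.ι_desc]
    exact LinearMap.congr_fun (hf i) _
  · intro L f hf
    have hi : ∀ i, ProjTrivial E (biproduct.ι W i ≫ f) := by
      intro i
      apply (h i).projTrivial
      refine LinearMap.ext fun y => ?_
      have h1 := LinearMap.congr_fun hf (push E (biproduct.ι Z i ≫ e.inv) L y)
      rw [LinearMap.comp_apply, hsum, Finset.sum_eq_single i] at h1
      · rw [← push_comp_apply] at h1
        simpa [push_id_apply] using h1
      · intro j _ hj
        rw [← push_comp_apply]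
        have h2 : (biproduct.ι Z i ≫ e.inv) ≫ e.hom ≫ biproduct.π Z j = 0 := by
          simp [biproduct.ι_π_ne Z hj.symm]
        rw [h2, hE.push_zero, LinearMap.zero_apply, map_zero, map_zero]
      · simp
    intro T
    have h3 : f = ∑ i, biproduct.π W i ≫ biproduct.ι W i ≫ f := by
      conv_lhs => rw [← Category.id_comp f, ← biproduct_total_fin W, Preadditive.sum_comp]
      simp only [Category.assoc]
    rw [h3, hE.pull_sum]
    exact Finset.sum_eq_zero fun i _ => by rw [pull_comp, hi i T, LinearMap.comp_zero]

end Representability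

/-! ### Almost split extensions -/

section AlmostSplit

variable {k : Type t} [CommRing k] {K : Type t} [AddCommGroup K] [Module k K]
  {C : Type u} [Category.{v} C] [Preadditive C] [Linear k C]
  [HasFiniteBiproducts C] {n : ℕ} (S : NExangulated.{t, w} k C n)

/-- A nonzero extension which is killed by all morphisms starting in `Z` that are not split
monomorphisms. -/
structure IsAlmostSplit (E : Cᵒᵖ ⥤ C ⥤ ModuleCat.{w} k) {Z W : C} (ε : Extn E W Z) : Prop where
  ne_zero : ε ≠ 0
  push_eq_zero : ∀ {A : C} (u : Z ⟶ A), (¬ ∃ r, u ≫ r = 𝟙 Z) → push E u W ε = 0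

/-- As `θ ≠ 0`, the first morphism of its realization is not a split monomorphism, so it kills `ε`;
the long exact sequence then makes `ε` a pullback of `θ`. -/
lemma IsAlmostSplit.exists_pull_eq {S : NExangulated.{t, w} k C n} (hn : 1 ≤ n) {Z W : C}
    {ε : Extn S.E W Z} (hε : IsAlmostSplit S.E ε) {L : C} (θ : Extn S.E L Z) (hθ : θ ≠ 0) :
    ∃ h : W ⟶ L, pull S.E h Z θ = ε := by
  obtain ⟨V, hV⟩ := S.exists_real θ
  refine S.exists_pull_eq hn hV ε (hε.push_eq_zero _ ?_)
  rintro ⟨r, hr⟩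
  apply hθ
  rw [← push_id_apply S.E θ, (S.push_eq_zero_iff hV _).2 ⟨r, hr⟩]

/-- The dual half of almost splitness. If `g^*ε ≠ 0`, it pulls back to `ε` along some `h`; then `1 -
h ≫ g` kills `ε`, so it is not invertible, and locality makes `h ≫ g` invertible. -/
lemma IsAlmostSplit.pull_eq_zero {S : NExangulated.{t, w} k C n} (hn : 1 ≤ n) {Z W : C}
    (hW : IsLocalRing (End W)) {ε : Extn S.E W Z} (hε : IsAlmostSplit S.E ε) {L : C}
    (g : L ⟶ W) (hg : ¬ ∃ r, r ≫ g = 𝟙 W) : pull S.E g Z ε = 0 := by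
  by_contra h0
  obtain ⟨h, hh⟩ := hε.exists_pull_eq hn _ h0
  rw [← pull_comp_apply] at hh
  rcases isIso_or_isIso_one_sub hW (h ≫ g) with h1 | h1
  · exact hg ⟨inv (h ≫ g) ≫ h, by rw [Category.assoc, IsIso.inv_hom_id]⟩
  · apply hε.ne_zero
    rw [← pull_id_apply S.E ε, ← IsIso.inv_hom_id (𝟙 W - h ≫ g), pull_comp_apply,
      S.bilinear.pull_sub, LinearMap.sub_apply, pull_id_apply, hh, sub_self, map_zero]

lemma IsAlmostSplit.exists_push_eq {S : NExangulated.{t, w} k C n} (hn : 1 ≤ n) {Z W : C}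
    (hW : IsLocalRing (End W)) {ε : Extn S.E W Z} (hε : IsAlmostSplit S.E ε) {T : C}
    (θ : Extn S.E W T) (hθ : θ ≠ 0) : ∃ f : T ⟶ Z, push S.E f W θ = ε := by
  obtain ⟨V, hV⟩ := S.exists_real θ
  refine S.exists_push_eq hn hV ε (hε.pull_eq_zero hn hW _ ?_)
  rintro ⟨r, hr⟩
  apply hθ
  rw [← pull_id_apply S.E θ, (S.pull_eq_zero_iff hV _).2 ⟨r, hr⟩]

/-- Auslander–Reiten duality for the first term of an almost split extension. -/
lemma IsAlmostSplit.exists_isUniversalForm [IsArtinianRing k] (hK : IsMinInjCogenerator k K)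
    {S : NExangulated.{t, w} k C n} (hfin : S.ExtFinite) (hn : 1 ≤ n) {Z W : C}
    (hW : IsLocalRing (End W)) {ε : Extn S.E W Z} (hε : IsAlmostSplit S.E ε) :
    ∃ η : Extn S.E W Z →ₗ[k] K, IsUniversalForm S.E η := by
  have := hfin Z W
  obtain ⟨η, hη⟩ := hK.exists_ne_zero hε.ne_zero
  refine ⟨η, fun L φ => ?_, fun L h hh T => LinearMap.ext fun θ => ?_⟩
  · have := hfin Z L
    let ψ : (W ⟶ L) →ₗ[k] (Extn S.E L Z →ₗ[k] K) :=
      { toFun := fun h => η ∘ₗ pull S.E h Z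
        map_add' := fun f g => by rw [S.bilinear.pull_add, LinearMap.comp_add]
        map_smul' := fun r f => by rw [S.bilinear.pull_smul, LinearMap.comp_smul, RingHom.id_apply] }
    -- The forms `η ∘ h^*` separate points, since every nonzero `θ` pulls back to `ε` and `η ε ≠ 0`.
    have htop : LinearMap.range ψ = ⊤ := by
      refine hK.eq_top _ fun θ hθ => ?_
      by_contra h0
      obtain ⟨h, hh⟩ := hε.exists_pull_eq hn θ h0
      apply hη
      rw [← hh]
      exact hθ _ ⟨h, rfl⟩
    exact LinearMap.range_eq_top.1 htop φ
  -- A nonzero `h^*θ` can be pushed to `ε` by some `f`; then `η ∘ h^*` is nonzero on `f_*θ`.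
  · by_contra h0
    obtain ⟨f, hf⟩ := hε.exists_push_eq hn hW _ h0
    apply hη
    rw [← hf, push_pull]
    exact LinearMap.congr_fun hh _

/-- If all morphisms from `Z` that are not split monomorphisms kill some nonzero extension of a
fixed object by `Z`, then there is an almost split extension starting in `Z`. -/
lemma NExangulated.exists_isAlmostSplit [IsArtinianRing k] (hC : KrullSchmidt C)
    (hfin : S.ExtFinite) {Z W : C} (hZ : IsLocalRing (End Z))
    (h : ∀ {A : C} (u : Z ⟶ A), (¬ ∃ r, u ≫ r = 𝟙 Z) →
      ∃ y : Extn S.E W Z, y ≠ 0 ∧ push S.E u W y = 0) :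
    ∃ (W' : C) (ε : Extn S.E W' Z), IsLocalRing (End W') ∧ IsAlmostSplit S.E ε := by
  have := hfin Z W
  let F : Set (Submodule k (Extn S.E W Z)) :=
    {N | ∃ (A : C) (u : Z ⟶ A), (¬ ∃ r, u ≫ r = 𝟙 Z) ∧ N = LinearMap.ker (push S.E u W)}
  have hF : F.Nonempty := by
    refine ⟨_, Z, 0, ?_, rfl⟩
    rintro ⟨r, hr⟩
    rw [zero_comp] at hr
    exact not_isZero_of_isLocalRing hZ ((IsZero.iff_id_eq_zero Z).2 hr.symm)
  obtain ⟨N, ⟨A₀, u₀, hu₀, rfl⟩, hmin⟩ := IsArtinian.set_has_minimal F hF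
  obtain ⟨ε, hε, hε₀⟩ := h u₀ hu₀
  have hkill : ∀ {A : C} (u : Z ⟶ A), (¬ ∃ r, u ≫ r = 𝟙 Z) → push S.E u W ε = 0 := by
    intro A u hu
    -- Locality of the endomorphism ring of `Z` makes non-split monomorphisms closed under pairing.
    -- The kernel of the pair lies in that of `u₀`, so minimality forces the kernel of `u₀` into
    -- every other kernel.
    have hl : ¬ ∃ r, biprod.lift u₀ u ≫ r = 𝟙 Z := by
      rintro ⟨r, hr⟩
      have h1 : 𝟙 Z - u₀ ≫ biprod.inl ≫ r = u ≫ biprod.inr ≫ r := by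
        rw [← hr, biprod.lift_eq]
        simp
      rcases isIso_or_isIso_one_sub hZ (u₀ ≫ biprod.inl ≫ r) with h2 | h2
      · exact hu₀ ⟨biprod.inl ≫ r ≫ inv (u₀ ≫ biprod.inl ≫ r), by
          have := IsIso.hom_inv_id (u₀ ≫ biprod.inl ≫ r)
          simpa only [Category.assoc] using this⟩
      · rw [h1] at h2
        exact hu ⟨biprod.inr ≫ r ≫ inv (u ≫ biprod.inr ≫ r), by
          have := IsIso.hom_inv_id (u ≫ biprod.inr ≫ r)
          simpa only [Category.assoc] using this⟩
    have hle : LinearMap.ker (push S.E (biprod.lift u₀ u) W) ≤ LinearMap.ker (push S.E u₀ W) := by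
      intro x hx
      rw [LinearMap.mem_ker] at hx ⊢
      rw [← biprod.lift_fst u₀ u, push_comp_apply, hx, map_zero]
    have heq := eq_of_le_of_not_lt hle (hmin _ ⟨_, _, hl, rfl⟩)
    have hε₁ : ε ∈ LinearMap.ker (push S.E (biprod.lift u₀ u) W) := by
      rw [heq]
      exact hε₀
    rw [LinearMap.mem_ker] at hε₁
    rw [← biprod.lift_snd u₀ u, push_comp_apply, hε₁, map_zero]
  -- Restricting `ε` to an indecomposable summand of `W` on which it is nonzero makes the other end
  -- local as well.
  obtain ⟨m, V, hV, ⟨e⟩⟩ := hC W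
  have hex : ∃ i, pull S.E (biproduct.ι V i ≫ e.inv) Z ε ≠ 0 := by
    by_contra! h0
    apply hε
    have h1 : ∑ i, (e.hom ≫ biproduct.π V i) ≫ biproduct.ι V i ≫ e.inv = 𝟙 W := by
      have h2 : e.hom ≫ (∑ i, biproduct.π V i ≫ biproduct.ι V i) ≫ e.inv = 𝟙 W := by
        rw [biproduct_total_fin]
        simp
      rw [← h2]
      simp only [Preadditive.sum_comp, Preadditive.comp_sum, Category.assoc]
    rw [← pull_id_apply S.E ε, ← h1, S.bilinear.pull_sum, LinearMap.sum_apply]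
    exact Finset.sum_eq_zero fun i _ => by rw [pull_comp_apply, h0, map_zero]
  obtain ⟨i, hi⟩ := hex
  exact ⟨V i, _, hV i, hi, fun u hu => by rw [push_pull, hkill u hu, map_zero]⟩

end AlmostSplit

/-! ### Morphisms determined by objects -/

section Determined

variable {k : Type t} [CommRing k] {K : Type t} [AddCommGroup K] [Module k K]
  {C : Type u} [Category.{v} C] [Preadditive C] [Linear k C]
  [HasFiniteBiproducts C] {n : ℕ} (S : NExangulated.{t, w} k C n)

lemma NExangulated.pull_eq_zero_iff_of_rightEquivalent {X Y Z : C} {α : X ⟶ Y}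
    {δ : Extn S.E Y Z} {U : EndedComplex n Z Y} (hU : S.Real δ U) (h : RightEquivalent U.last α)
    {T : C} (g : T ⟶ Y) : pull S.E g Z δ = 0 ↔ ∃ s, s ≫ α = g := by
  obtain ⟨⟨a, ha⟩, b, hb⟩ := h
  rw [S.pull_eq_zero_iff hU]
  constructor
  · rintro ⟨s, hs⟩
    exact ⟨s ≫ a, by rw [Category.assoc, ha, hs]⟩
  · rintro ⟨s, hs⟩
    exact ⟨s ≫ b, by rw [Category.assoc, hb, hs]⟩

/-- The determining object is the one representing the dual functor: every form detecting an
obstruction `g^*δ` comes from a morphism out of it. -/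
lemma NExangulated.rightDetermined_of_inCl (hK : IsInjCogenerator k K) (hfin : S.ExtFinite)
    {X Y Z : C} {α : X ⟶ Y} (hZ : S.IsIntrinsicWeakKernel α Z) (hCl : S.InCl K Z) :
    ∃ W : C, RightDetermined α W := by
  obtain ⟨δ, U, hU, -, hα⟩ := hZ
  obtain ⟨W, η, hη⟩ := S.exists_form_of_inCl hCl
  refine ⟨W, fun L g hg => ?_⟩
  rw [← S.pull_eq_zero_iff_of_rightEquivalent hU hα]
  by_contra h0
  have := hfin Z L
  obtain ⟨φ, hφ⟩ := hK.exists_ne_zero h0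
  obtain ⟨h, rfl⟩ := hη L φ
  apply hφ
  rw [LinearMap.comp_apply, ← pull_comp_apply,
    (S.pull_eq_zero_iff_of_rightEquivalent hU hα _).2 (hg h), map_zero]

/-- If `α` is right `W`-determined and has the minimal intrinsic weak kernel `Z`, then every
morphism from `Z` that is not a split monomorphism kills a nonzero extension of `W` by `Z`. -/
lemma NExangulated.exists_push_eq_zero (hn : 1 ≤ n) {X Y Z W : C} {α : X ⟶ Y}
    (hα : RightDetermined α W) (hZ : S.IsMinimalIntrinsicWeakKernel α Z) {T : C} (φ : Z ⟶ T)
    (hφ : ¬ ∃ r, φ ≫ r = 𝟙 Z) : ∃ x : Extn S.E W Z, x ≠ 0 ∧ push S.E φ W x = 0 := by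
  obtain ⟨δ, U, hU, -, hUα, hrad⟩ := hZ
  have hfirst : InRad U.first := EndedComplex.inRad_first (hrad 0 (by omega))
  obtain ⟨V, hV⟩ := S.exists_real (push S.E φ Y δ)
  -- If this pullback vanished, `δ` would be `a_*φ_*δ` for some `a`. Then `1 - φ ≫ a` would factor
  -- through the radical first morphism, making `φ ≫ a` invertible and `φ` split.
  have hne : pull S.E V.last Z δ ≠ 0 := by
    intro h0
    obtain ⟨a, ha⟩ := S.exists_push_eq hn hV δ h0
    have h1 : push S.E (𝟙 Z - φ ≫ a) Y δ = 0 := by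
      rw [S.bilinear.push_sub, LinearMap.sub_apply, push_id_apply, push_comp_apply, ha, sub_self]
    obtain ⟨s, hs⟩ := (S.push_eq_zero_iff hU _).1 h1
    have h2 := hfirst s
    rw [hs, sub_sub_cancel] at h2
    exact hφ ⟨a ≫ inv (φ ≫ a), by rw [← Category.assoc, IsIso.hom_inv_id]⟩
  have hex : ∃ h : W ⟶ V.cpx.X n, pull S.E (h ≫ V.last) Z δ ≠ 0 := by
    by_contra! h0
    refine hne ((S.pull_eq_zero_iff_of_rightEquivalent hU hUα _).2 (hα _ _ fun h => ?_))
    exact (S.pull_eq_zero_iff_of_rightEquivalent hU hUα _).1 (h0 h)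
  obtain ⟨h, hh⟩ := hex
  exact ⟨_, hh, by rw [push_pull, pull_comp_apply, (S.isExangle _ _ hV).last_pull, map_zero]⟩

lemma NExangulated.inCl_of_rightDetermined [IsArtinianRing k] (hK : IsMinInjCogenerator k K)
    (hC : KrullSchmidt C) (hn : 1 ≤ n) (hfin : S.ExtFinite) {X Y Z W : C} {α : X ⟶ Y}
    (hα : RightDetermined α W) (hZ : S.IsMinimalIntrinsicWeakKernel α Z) : S.InCl K Z := by
  obtain ⟨m, V, hV, ⟨e⟩⟩ := hC Z
  have key : ∀ i, ∃ (W' : C) (η : Extn S.E W' (V i) →ₗ[k] K), IsUniversalForm S.E η := by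
    intro i
    let ι := biproduct.ι V i ≫ e.inv
    let π := e.hom ≫ biproduct.π V i
    have hιπ : ι ≫ π = 𝟙 (V i) := by simp [ι, π]
    obtain ⟨W', ε, hW', hε⟩ := S.exists_isAlmostSplit hC hfin (W := W) (hV i) (fun {A} u hu => by
      -- Adding the component `1 - π ≫ ι` extends `u` from the summand to `Z` and forces the killed
      -- element `x` to come from the summand: `x = ι_*π_*x`, so `π_*x ≠ 0`.
      obtain ⟨x, hx, hφ⟩ := S.exists_push_eq_zero hn hα hZ (biprod.lift (π ≫ u) (𝟙 Z - π ≫ ι)) (by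
        rintro ⟨r, hr⟩
        refine hu ⟨biprod.inl ≫ r ≫ π, ?_⟩
        have h1 : ι ≫ biprod.lift (π ≫ u) (𝟙 Z - π ≫ ι) = u ≫ biprod.inl := by
          ext
          · simp [reassoc_of% hιπ]
          · simp [reassoc_of% hιπ]
        rw [← reassoc_of% h1, reassoc_of% hr, hιπ])
      have h1 : push S.E (π ≫ u) W x = 0 := by
        rw [← biprod.lift_fst (π ≫ u) (𝟙 Z - π ≫ ι), push_comp_apply, hφ, map_zero]
      have h2 : push S.E (𝟙 Z - π ≫ ι) W x = 0 := by
        rw [← biprod.lift_snd (π ≫ u) (𝟙 Z - π ≫ ι), push_comp_apply, hφ, map_zero]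
      refine ⟨push S.E π W x, fun h0 => hx ?_, by rw [← push_comp_apply, h1]⟩
      rw [S.bilinear.push_sub, LinearMap.sub_apply, push_id_apply, push_comp_apply, h0, map_zero,
        sub_zero] at h2
      exact h2)
    obtain ⟨η, hη⟩ := hε.exists_isUniversalForm hK hfin hn hW'
    exact ⟨W', η, hη⟩
  choose W' η hη using key
  exact S.inCl_of_isUniversalForm (IsUniversalForm.of_biproduct S.bilinear e hη)

end Determined

end NExang

end

theorem proposition4p14 {k : Type t} [CommRing k] [IsArtinianRing k]
    {K : Type t} [AddCommGroup K] [Module k K] (hK : NExang.IsMinInjCogenerator k K)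
    {C : Type u} [Category.{v} C] [Preadditive C] [Linear k C] [HasFiniteBiproducts C]
    (hC : NExang.KrullSchmidt C) {n : ℕ} (hn : 1 ≤ n) (S : NExang.NExangulated.{t, w} k C n)
    (hfin : S.ExtFinite) (hwic : S.WIC) {X Y : C} (α : X ⟶ Y) (hα : S.IsDeflation α) :
    (∃ Z : C, S.IsMinimalIntrinsicWeakKernel α Z) ∧
    ∀ Z : C, S.IsMinimalIntrinsicWeakKernel α Z →
      List.TFAE [
        ∃ W : C, NExang.RightDetermined α W,
        S.InCl K Z,
        ∃ Z' : C, S.IsIntrinsicWeakKernel α Z' ∧ S.InCl K Z'] := by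
  refine ⟨S.exists_isMinimalIntrinsicWeakKernel hC hn hwic α hα, fun Z hZ => ?_⟩
  tfae_have 1 → 2 := fun ⟨W, hW⟩ => S.inCl_of_rightDetermined hK hC hn hfin hW hZ
  tfae_have 2 → 3 := fun h => by
    obtain ⟨δ, U, hU, hmin, heq, -⟩ := hZ
    exact ⟨Z, ⟨δ, U, hU, hmin, heq⟩, h⟩
  tfae_have 3 → 1 := fun ⟨_, hZ', h⟩ =>
    S.rightDetermined_of_inCl hK.toIsInjCogenerator hfin hZ' h
  tfae_finish
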